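/- **Setting.** Let $0\le c<1<d\le 2$, $\Omega=(c,d)$, $\Omega_0=\Omega\setminus\{1\}$, and let $a:[c,d]\to\mathbb R$ satisfy: (i) $a(1)=0$, $a>0$ on $[c,d]\setminus\{1\}$, and there are $x_1^*\in[c,1)$ and $x_2^*\in(1,d]$ such that $a$ is decreasing on $(x_1^*,1)$, increasing on $(1,x_2^*)$, and $$\sup_{x\in[x_1^*,1)}\frac{(1-x)|a'(x)|}{a(x)}=\lim_{x\nearrow1}\frac{(1-x)|a'(x)|}{a(x)}\in(0,\infty),\qquad \sup_{x\in(1,x_2^*]}\frac{(x-1)|a'(x)|}{a(x)}=\lim_{x\searrow1}\frac{(x-1)|a'(x)|}{a(x)}\in(0,\infty);$$ (ii) $a\in C([c,d])\cap C^1([c,d]\setminus\{1\})$; (iii) $(\sqrt a)_x\notin L^\infty(\Omega)$, while its reciprocal $1/(\sqrt a)_x$ belongs to $L^\infty(\Omega)$ (in particular $(\sqrt a)_x\neq0$ a.e.). The degeneration is called weak if $1/a\in L^1(\Omega)$ and strong otherwise. Put $\|u\|_a^2=\int_\Omega (u^2+a\,u_x^2)\,dx$. * $H^1_a(\Omega)$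 and $H^1_{a,0}(\Omega)$ are the closures of $C^\infty(\overline\Omega)$ and of $C_c^\infty(\Omega)$ in the norm $\|\cdot\|_a$ (within the functions $u\in L^2(\Omega)$ that have a distributional derivative $u_x$ on $\Omega_0$ with $\|u\|_a<\infty$). * $W^1_a(\Omega)$ is the set of $u\in L^2(\Omega)$ with $\int_\Omega a\,u_x^2\,dx<\infty$, where, for a weak degeneration, $u_x\in L^1(\Omega)$ is the distributional derivative of $u$ on $\Omega$ and, for a strong degeneration, $u_x$ is the distributional derivative of $u$ on $\Omega_0$. Further, $W^1_{a,0}(\Omega)=\{u\in W^1_a(\Omega): u(c)=u(d)=0\}$. * $W^2_a(\Omega)=\{u\in W^1_a(\Omega): a u_x\in W^{1,2}(\Omega)\}$ and $H^2_a(\Omega)=\{u\in H^1_a(\Omega): a u_x\in W^{1,2}(\Omega)\}$. Let $V=V^1_{a,0}(\Omega)$ be a linear space, closed in the norm $\|\cdot\|_a$, with $H^1_{a,0}(\Omega)\subseteq V\subseteq W^1_{a,0}(\Omega)$. Equip it with the scalar product $\int_\Omega a\,u_xw_x\,dx$, and let $\mathcal H_a=V\times L^2(\Omega)$ with the product scalar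 product. Let $\mathcal A(u,v)=(v,(a u_x)_x)$ be the operator in $\mathcal H_a$ whose domain consists of all $(u,v)$ with $u\in V\cap W^2_a(\Omega)$, $v\in V$, subject to the transmission conditions * $\lim_{x\nearrow1}u=\lim_{x\searrow1}u$ and $\lim_{x\nearrow1}a u_x=\lim_{x\searrow1}a u_x$, if the degeneration is weak; * $\lim_{x\nearrow1}a\varphi_xu=0=\lim_{x\searrow1}a\varphi_xu$ for all $\varphi\in H^2_a(\Omega)$ and $\lim_{x\nearrow1}a u_x=0=\lim_{x\searrow1}a u_x$, if the degeneration is strong. For $y_0\in V$ and $y_1\in L^2(\Omega)$, the $V^1_a$-mild solution, with data $(y_0,y_1)$, of the homogeneous transmission problem $y_{tt}=(a y_x)_x$, $y(t,c)=y(t,d)=0$, is the function $y\in C^1([0,\infty);L^2(\Omega))\cap C([0,\infty);V)$ such that $y(t)$ is the first component of $e^{\mathcal A t}(y_0,y_1)$ for all $t\ge0$, where $e^{\mathcal A t}$ is the strongly continuous semigroup on $\mathcal H_a$ generated by $\mathcal A$. Its energy is $$E_y(t)=\frac12\int_{\Omega_0}\bigl[y_t^2(t,x)+a(x)\,y_x^2(t,x)\bigr]\,dx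 .$$ **Proposition.** Let $0\le c<1<d\le2$, let $a$ satisfy (i)–(iii), with weak or strong degeneration, and let $V$ be as above. Then the energy of every $V^1_a$-mild solution $y$ is constant in time: $$E_y(t)=E_y(0)\qquad\text{for all } t\ge0 .$$ -/

import Mathlib

open MeasureTheory Set Filter Topology
open scoped ContDiff ENNReal

noncomputable section

/-! ## Weak derivatives on open subsets of the line -/

/-- `g` is the weak (distributional) derivative of `u` on the open set `U`. -/
def HasWeakDerivOn (U : Set ℝ) (u g : ℝ → ℝ) : Prop :=
  LocallyIntegrableOn u U ∧ LocallyIntegrableOn g U ∧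
    ∀ φ : ℝ → ℝ, ContDiff ℝ ∞ φ → HasCompactSupport φ → tsupport φ ⊆ U →
      ∫ x in U, u x * deriv φ x = -∫ x in U, g x * φ x

open Classical in
/-- The weak derivative of `u` on `U`, unique up to null subsets of `U` (zero if there is none). -/
def weakDeriv (U : Set ℝ) (u : ℝ → ℝ) : ℝ → ℝ :=
  if h : ∃ g, HasWeakDerivOn U u g then h.choose else 0

theorem hasWeakDerivOn_weakDeriv {U : Set ℝ} {u : ℝ → ℝ} (h : ∃ g, HasWeakDerivOn U u g) :
    HasWeakDerivOn U u (weakDeriv U u) := by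
  rw [weakDeriv, dif_pos h]
  exact h.choose_spec

theorem integrable_mul_test {U : Set ℝ} {u φ : ℝ → ℝ} (hu : LocallyIntegrableOn u U)
    (hφ : Continuous φ) (hc : HasCompactSupport φ) (hs : tsupport φ ⊆ U) :
    Integrable (fun x => u x * φ x) := by
  have h1 : IntegrableOn (fun x => u x * φ x) (tsupport φ) :=
    (hu.integrableOn_compact_subset hs hc).mul_continuousOn hφ.continuousOn hc
  refine (integrableOn_iff_integrable_of_support_subset ?_).1 h1
  intro x hx
  refine subset_tsupport φ ?_
  simp only [Function.mem_support] at hx ⊢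
  exact right_ne_zero_of_mul hx

theorem tsupport_deriv_sub {φ : ℝ → ℝ} {U : Set ℝ} (hs : tsupport φ ⊆ U) :
    tsupport (deriv φ) ⊆ U := tsupport_deriv_subset.trans hs

theorem HasWeakDerivOn.add {U : Set ℝ} {u g v h : ℝ → ℝ} (hu : HasWeakDerivOn U u g)
    (hv : HasWeakDerivOn U v h) :
    HasWeakDerivOn U (fun x => u x + v x) (fun x => g x + h x) := by
  refine ⟨hu.1.add hv.1, hu.2.1.add hv.2.1, fun φ h1 h2 h3 => ?_⟩
  have hd : Continuous (deriv φ) := h1.continuous_deriv (by simp)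
  have e1 := integrable_mul_test hu.1 hd h2.deriv (tsupport_deriv_sub h3)
  have e2 := integrable_mul_test hv.1 hd h2.deriv (tsupport_deriv_sub h3)
  have e3 := integrable_mul_test hu.2.1 h1.continuous h2 h3
  have e4 := integrable_mul_test hv.2.1 h1.continuous h2 h3
  simp only [add_mul]
  rw [integral_add e1.integrableOn e2.integrableOn, integral_add e3.integrableOn e4.integrableOn,
    hu.2.2 φ h1 h2 h3, hv.2.2 φ h1 h2 h3]
  ring

theorem HasWeakDerivOn.const_mul {U : Set ℝ} {u g : ℝ → ℝ} (hu : HasWeakDerivOn U u g) (r : ℝ) :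
    HasWeakDerivOn U (fun x => r * u x) (fun x => r * g x) := by
  refine ⟨hu.1.smul r, hu.2.1.smul r, fun φ h1 h2 h3 => ?_⟩
  simp only [mul_assoc, integral_const_mul]
  rw [hu.2.2 φ h1 h2 h3]
  ring

theorem HasWeakDerivOn.congr {U : Set ℝ} {u v g h : ℝ → ℝ} (hu : HasWeakDerivOn U u g)
    (huv : u =ᵐ[volume.restrict U] v) (hgh : g =ᵐ[volume.restrict U] h) :
    HasWeakDerivOn U v h := by
  refine ⟨hu.1.congr huv, hu.2.1.congr hgh, fun φ h1 h2 h3 => ?_⟩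
  have e1 : ∫ x in U, v x * deriv φ x = ∫ x in U, u x * deriv φ x :=
    integral_congr_ae (by
      filter_upwards [huv] with x hx
      rw [hx])
  have e2 : ∫ x in U, h x * φ x = ∫ x in U, g x * φ x :=
    integral_congr_ae (by
      filter_upwards [hgh] with x hx
      rw [hx])
  rw [e1, e2]
  exact hu.2.2 φ h1 h2 h3

theorem setIntegral_test {U : Set ℝ} {u φ : ℝ → ℝ} (hs : tsupport φ ⊆ U) :
    ∫ x in U, u x * φ x = ∫ x, u x * φ x := by
  refine setIntegral_eq_integral_of_forall_compl_eq_zero fun x hx => ?_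
  rw [image_eq_zero_of_notMem_tsupport fun h => hx (hs h), mul_zero]

theorem HasWeakDerivOn.mono {U W : Set ℝ} {u g : ℝ → ℝ} (hu : HasWeakDerivOn U u g)
    (hW : W ⊆ U) : HasWeakDerivOn W u g := by
  refine ⟨hu.1.mono_set hW, hu.2.1.mono_set hW, fun φ h1 h2 h3 => ?_⟩
  have := hu.2.2 φ h1 h2 (h3.trans hW)
  rw [setIntegral_test (tsupport_deriv_sub (h3.trans hW)), setIntegral_test (h3.trans hW)] at this
  rw [setIntegral_test (tsupport_deriv_sub h3), setIntegral_test h3, this]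

theorem HasWeakDerivOn.unique {U : Set ℝ} (hU : IsOpen U) {u g h : ℝ → ℝ}
    (hg : HasWeakDerivOn U u g) (hh : HasWeakDerivOn U u h) : g =ᵐ[volume.restrict U] h := by
  have key := hU.ae_eq_zero_of_integral_contDiff_smul_eq_zero (hg.2.1.sub hh.2.1)
    (fun φ h1 h2 h3 => by
      have e3 := integrable_mul_test hg.2.1 h1.continuous h2 h3
      have e4 := integrable_mul_test hh.2.1 h1.continuous h2 h3
      have := (hg.2.2 φ h1 h2 h3).symm.trans (hh.2.2 φ h1 h2 h3)
      rw [setIntegral_test h3, setIntegral_test h3] at this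
      calc ∫ x, φ x • (g - h) x = ∫ x, (g x * φ x - h x * φ x) := by
            congr 1
            ext x
            simp only [Pi.sub_apply, smul_eq_mul]
            ring
        _ = 0 := by
            rw [integral_sub e3 e4]
            linarith)
  filter_upwards [(ae_restrict_iff' hU.measurableSet).2 key] with x hx
  simpa [sub_eq_zero] using hx

theorem weakDeriv_ae {U : Set ℝ} (hU : IsOpen U) {u g : ℝ → ℝ} (h : HasWeakDerivOn U u g) :
    weakDeriv U u =ᵐ[volume.restrict U] g :=
  (hasWeakDerivOn_weakDeriv ⟨g, h⟩).unique hU h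

/-- A function with vanishing weak derivative on an interval is a.e. constant there. -/
theorem HasWeakDerivOn.ae_const {p q : ℝ} (hpq : p < q) {u : ℝ → ℝ}
    (h : HasWeakDerivOn (Ioo p q) u (fun _ => 0)) :
    ∃ k : ℝ, u =ᵐ[volume.restrict (Ioo p q)] fun _ => k := by
  obtain ⟨m, hm⟩ : (Ioo p q).Nonempty := nonempty_Ioo.2 hpq
  obtain ⟨r, hr, hball⟩ := Metric.isOpen_iff.1 isOpen_Ioo m hm
  let B : ContDiffBump m := ⟨r / 4, r / 2, by positivity, by linarith⟩
  let ψ : ℝ → ℝ := B.normed volume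
  have hψ1 : ContDiff ℝ ∞ ψ := B.contDiff_normed
  have hψ2 : HasCompactSupport ψ := B.hasCompactSupport_normed
  have hψ3 : tsupport ψ ⊆ Ioo p q := by
    rw [show tsupport ψ = Metric.closedBall m B.rOut from B.tsupport_normed_eq]
    exact (Metric.closedBall_subset_ball (by change r / 2 < r; linarith)).trans hball
  have hψ4 : ∫ x, ψ x = 1 := B.integral_normed
  set k : ℝ := ∫ x, u x * ψ x with hk
  refine ⟨k, ?_⟩
  have hloc : LocallyIntegrableOn (fun x => u x - k) (Ioo p q) :=
    h.1.sub (locallyIntegrableOn_const k)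
  have key := isOpen_Ioo.ae_eq_zero_of_integral_contDiff_smul_eq_zero hloc
    (fun φ h1 h2 h3 => by
      set I : ℝ := ∫ x, φ x with hI
      let η : ℝ → ℝ := fun x => φ x - I * ψ x
      have hη1 : ContDiff ℝ ∞ η := h1.sub (contDiff_const.mul hψ1)
      have iφ : Integrable φ := h1.continuous.integrable_of_hasCompactSupport h2
      have iψ : Integrable ψ := hψ1.continuous.integrable_of_hasCompactSupport hψ2
      have iη : Integrable η := iφ.sub (iψ.const_mul I)
      have hη0 : ∫ x, η x = 0 := by
        rw [integral_sub iφ (iψ.const_mul I), integral_const_mul, hψ4]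
        simp [hI]
      -- a compact interval that carries the supports
      have hK : IsCompact (tsupport φ ∪ tsupport ψ) := h2.isCompact.union hψ2.isCompact
      have hKn : (tsupport φ ∪ tsupport ψ).Nonempty := by
        refine ⟨m, Or.inr ?_⟩
        rw [show tsupport ψ = Metric.closedBall m B.rOut from B.tsupport_normed_eq]
        exact Metric.mem_closedBall_self (by change 0 ≤ r / 2; linarith)
      obtain ⟨p', hp'⟩ := hK.exists_isLeast hKn
      obtain ⟨q', hq'⟩ := hK.exists_isGreatest hKn
      have hp1 : p' ∈ Ioo p q := hp'.1.elim (fun z => h3 z) (fun z => hψ3 z)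
      have hq1 : q' ∈ Ioo p q := hq'.1.elim (fun z => h3 z) (fun z => hψ3 z)
      have hz : ∀ x, x ∉ Icc p' q' → η x = 0 := by
        intro x hx
        have hx' : x ∉ tsupport φ ∪ tsupport ψ := fun hh => hx ⟨hp'.2 hh, hq'.2 hh⟩
        have a1 := image_eq_zero_of_notMem_tsupport (fun z => hx' (Or.inl z))
        have a2 := image_eq_zero_of_notMem_tsupport (fun z => hx' (Or.inr z))
        simp [η, a1, a2]
      let Φ : ℝ → ℝ := fun x => ∫ t in p..x, η t
      have hΦd : ∀ x, HasDerivAt Φ (η x) x := fun x =>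
        intervalIntegral.integral_hasDerivAt_right (iη.intervalIntegrable)
          (hη1.continuous.stronglyMeasurableAtFilter _ _) hη1.continuous.continuousAt
      have hΦ' : deriv Φ = η := funext fun x => (hΦd x).deriv
      have hΦ1 : ContDiff ℝ ∞ Φ := by
        rw [contDiff_infty_iff_deriv]
        exact ⟨fun x => (hΦd x).differentiableAt, by rw [hΦ']; exact hη1⟩
      have hsupp : Function.support Φ ⊆ Icc p' q' := by
        intro x hx
        by_contra hcon
        apply hx
        rcases lt_or_ge x p' with hlt | hge
        · change ∫ t in p..x, η t = 0
          have : ∀ t ∈ uIcc p x, η t = (fun _ => (0 : ℝ)) t := by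
            intro t ht
            refine hz t fun hh => ?_
            rcases le_max_iff.1 ht.2 with h5 | h5
            · exact absurd (hp1.1.trans_le hh.1) (not_lt.2 h5)
            · exact absurd (hlt.trans_le hh.1) (not_lt.2 h5)
          rw [intervalIntegral.integral_congr this]
          simp
        · have hgt : q' < x := not_le.1 fun hh => hcon ⟨hge, hh⟩
          change ∫ t in p..x, η t = 0
          rw [intervalIntegral.integral_of_le (by linarith [hp1.1]),
            setIntegral_eq_integral_of_forall_compl_eq_zero, hη0]
          intro t ht
          refine hz t fun hh => ht ⟨hp1.1.trans_le hh.1, hh.2.trans hgt.le⟩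
      have hts : tsupport Φ ⊆ Icc p' q' := closure_minimal hsupp isClosed_Icc
      have hΦ2 : HasCompactSupport Φ :=
        isCompact_Icc.of_isClosed_subset (isClosed_tsupport _) hts
      have hΦ3 : tsupport Φ ⊆ Ioo p q :=
        hts.trans fun x hx => ⟨hp1.1.trans_le hx.1, hx.2.trans_lt hq1.2⟩
      have e := h.2.2 Φ hΦ1 hΦ2 hΦ3
      rw [setIntegral_test (tsupport_deriv_sub hΦ3), hΦ'] at e
      simp only [zero_mul, integral_zero, neg_zero] at e
      have iuφ := integrable_mul_test h.1 h1.continuous h2 h3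
      have iuψ := integrable_mul_test h.1 hψ1.continuous hψ2 hψ3
      have e2 : ∫ x, u x * η x = (∫ x, u x * φ x) - I * k := by
        rw [hk, ← integral_const_mul, ← integral_sub iuφ (iuψ.const_mul I)]
        congr 1
        ext x
        simp only [η]
        ring
      calc ∫ x, φ x • (u x - k) = ∫ x, (u x * φ x - k * φ x) := by
            congr 1
            ext x
            simp only [smul_eq_mul]
            ring
        _ = (∫ x, u x * φ x) - k * I := by
            rw [integral_sub iuφ (iφ.const_mul k), integral_const_mul]
        _ = 0 := by
            rw [e] at e2
            linarith)
  filter_upwards [(ae_restrict_iff' measurableSet_Ioo).2 key] with x hx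
  simpa [sub_eq_zero] using hx

/-! ## The degenerate weight -/

/-- A weight `a` on `[c, d]`, `0 ≤ c < 1 < d ≤ 2`, that degenerates exactly at the point `1`:
* `a 1 = 0`, `a > 0` elsewhere, `a` is decreasing on some `(x₁, 1)` and increasing on some
  `(1, x₂)`, and on either side the supremum of `|x - 1| |a'| / a` over `[x₁, 1)`, respectively
  `(1, x₂]`, is finite, positive, and equal to the limit at `1`;
* `a` is continuous on `[c, d]` and continuously differentiable on `[c, d] ∖ {1}`;
* `(√a)'` is not essentially bounded, whereas its reciprocal is. -/
structure DegenerateWeight (c d : ℝ) where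
  toFun : ℝ → ℝ
  c_nonneg : 0 ≤ c
  c_lt_one : c < 1
  one_lt_d : 1 < d
  d_le_two : d ≤ 2
  map_one : toFun 1 = 0
  pos : ∀ x ∈ Icc c d, x ≠ 1 → 0 < toFun x
  left : ∃ x₁ ∈ Ico c 1, AntitoneOn toFun (Ioo x₁ 1) ∧ ∃ μ₁ : ℝ, 0 < μ₁ ∧
    IsLUB ((fun x => (1 - x) * |derivWithin toFun (Icc c d \ {1}) x| / toFun x) '' Ico x₁ 1) μ₁ ∧
    Tendsto (fun x => (1 - x) * |derivWithin toFun (Icc c d \ {1}) x| / toFun x) (𝓝[<] 1) (𝓝 μ₁)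
  right : ∃ x₂ ∈ Ioc 1 d, MonotoneOn toFun (Ioo 1 x₂) ∧ ∃ μ₂ : ℝ, 0 < μ₂ ∧
    IsLUB ((fun x => (x - 1) * |derivWithin toFun (Icc c d \ {1}) x| / toFun x) '' Ioc 1 x₂) μ₂ ∧
    Tendsto (fun x => (x - 1) * |derivWithin toFun (Icc c d \ {1}) x| / toFun x) (𝓝[>] 1) (𝓝 μ₂)
  continuousOn : ContinuousOn toFun (Icc c d)
  contDiffOn : ContDiffOn ℝ 1 toFun (Icc c d \ {1})
  deriv_sqrt_not_memLp :
    ¬ MemLp (deriv fun x => √(toFun x)) ∞ (volume.restrict (Ioo c d))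
  deriv_sqrt_ne_zero :
    ∀ᵐ x ∂(volume.restrict (Ioo c d)), deriv (fun x => √(toFun x)) x ≠ 0
  inv_deriv_sqrt_memLp :
    MemLp (fun x => (deriv (fun x => √(toFun x)) x)⁻¹) ∞ (volume.restrict (Ioo c d))

instance (c d : ℝ) : CoeFun (DegenerateWeight c d) fun _ => ℝ → ℝ := ⟨DegenerateWeight.toFun⟩

/-- Weak degeneration: `1 / a ∈ L¹(c, d)`. Otherwise the degeneration is strong. -/
def DegenerateWeight.IsWeak {c d : ℝ} (a : DegenerateWeight c d) : Prop :=
  IntegrableOn (fun x => 1 / a x) (Ioo c d)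

/-! ## Weighted Sobolev spaces -/

/-- The real Hilbert space `L²(c, d)`. -/
abbrev L2 (c d : ℝ) : Type := Lp ℝ 2 (volume.restrict (Ioo c d))

/-- The derivative `u_x`, taken in the sense of distributions on `(c, d) ∖ {1}`. -/
def spaceDeriv {c d : ℝ} (u : L2 c d) : ℝ → ℝ := weakDeriv (Ioo c d \ {1}) u

/-- The essential limit of `f` at `p` from the left is `l`. For a function that is a.e. equal to one
which is continuous on that side of `p`, this is the usual limit of the continuous representative. -/
def EssTendstoLeft (f : ℝ → ℝ) (p l : ℝ) : Prop := Tendsto f (𝓝[<] p ⊓ ae volume) (𝓝 l)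

/-- The essential limit from the right. -/
def EssTendstoRight (f : ℝ → ℝ) (p l : ℝ) : Prop := Tendsto f (𝓝[>] p ⊓ ae volume) (𝓝 l)

section Spaces

variable {c d : ℝ} (a : DegenerateWeight c d)

/-- The functions `u ∈ L²(c, d)` whose norm `‖u‖_a = (∫ u² + a u_x²)^{1/2}` is finite. -/
def FiniteNorm (u : L2 c d) : Prop :=
  ∃ g, HasWeakDerivOn (Ioo c d \ {1}) u g ∧ IntegrableOn (fun x => a x * g x ^ 2) (Ioo c d)

/-- The squared distance `∫ (u - f)² + a (u_x - f')²`, with `f'` the derivative of `f`. -/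
def distSq (u : L2 c d) (f f' : ℝ → ℝ) : ℝ :=
  ∫ x in Ioo c d, ((u x - f x) ^ 2 + a x * (spaceDeriv u x - f' x) ^ 2)

/-- `H¹_a`: the closure of `C^∞([c, d])` in the norm `‖·‖_a`. -/
def H1 : Set (L2 c d) :=
  {u | FiniteNorm a u ∧ ∀ ε > 0, ∃ φ : ℝ → ℝ, ContDiff ℝ ∞ φ ∧ distSq a u φ (deriv φ) < ε}

/-- `H¹_{a,0}`: the closure of `C_c^∞(c, d)` in the norm `‖·‖_a`. -/
def H10 : Set (L2 c d) :=
  {u | FiniteNorm a u ∧ ∀ ε > 0, ∃ φ : ℝ → ℝ, ContDiff ℝ ∞ φ ∧ HasCompactSupport φ ∧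
    tsupport φ ⊆ Ioo c d ∧ distSq a u φ (deriv φ) < ε}

/-- `W¹_a`: the functions `u ∈ L²(c, d)` with distributional derivative `u_x ∈ L²(a dx)`. For a weak
degeneration `u_x ∈ L¹(c, d)` is the distributional derivative on all of `(c, d)`; for a strong
degeneration, where `u` may be singular at `1`, it is the one on `(c, d) ∖ {1}`. -/
def W1 : Set (L2 c d) :=
  {u | ∃ g, HasWeakDerivOn (Ioo c d \ {1}) u g ∧
    IntegrableOn (fun x => a x * g x ^ 2) (Ioo c d) ∧
    (a.IsWeak → HasWeakDerivOn (Ioo c d) u g ∧ IntegrableOn g (Ioo c d))}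

/-- `W¹_{a,0}`: the elements of `W¹_a` with `u(c) = u(d) = 0`. -/
def W10 : Set (L2 c d) :=
  {u | u ∈ W1 a ∧ EssTendstoRight u c 0 ∧ EssTendstoLeft u d 0}

/-- The unweighted Sobolev space `W^{1,2}(c, d)`. -/
def MemW12 (c d : ℝ) (f : ℝ → ℝ) : Prop :=
  MemLp f 2 (volume.restrict (Ioo c d)) ∧
    ∃ g, MemLp g 2 (volume.restrict (Ioo c d)) ∧ HasWeakDerivOn (Ioo c d) f g

/-- The flux `a u_x`. -/
def flux (u : L2 c d) : ℝ → ℝ := fun x => a x * spaceDeriv u x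

/-- `W²_a`: the elements of `W¹_a` with flux in `W^{1,2}(c, d)`. -/
def W2 : Set (L2 c d) := {u | u ∈ W1 a ∧ MemW12 c d (flux a u)}

/-- `H²_a`: the elements of `H¹_a` with flux in `W^{1,2}(c, d)`. -/
def H2 : Set (L2 c d) := {u | u ∈ H1 a ∧ MemW12 c d (flux a u)}

/-- An intermediate space `H¹_{a,0} ⊆ V ⊆ W¹_{a,0}`: a linear subspace, closed in `‖·‖_a`. -/
structure IntermediateSpace where
  carrier : Submodule ℝ (L2 c d)
  H10_subset : H10 a ⊆ carrier
  subset_W10 : (carrier : Set (L2 c d)) ⊆ W10 a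
  closed : ∀ u ∈ W1 a, (∀ ε > 0, ∃ w ∈ carrier, distSq a u w (spaceDeriv w) < ε) → u ∈ carrier

end Spaces

/-! ## The Hilbert space structure on `V`, with scalar product `∫ a u_x w_x` -/

section Energy

variable {c d : ℝ} {a : DegenerateWeight c d}

theorem isOpen_punctured (c d : ℝ) : IsOpen (Ioo c d \ {1} : Set ℝ) :=
  isOpen_Ioo.sdiff isClosed_singleton

theorem restrict_punctured (c d : ℝ) :
    (volume.restrict (Ioo c d \ {1}) : Measure ℝ) = volume.restrict (Ioo c d) :=
  Measure.restrict_congr_set (sdiff_null_ae_eq_self (by simp))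

theorem DegenerateWeight.nonneg (a : DegenerateWeight c d) {x : ℝ} (hx : x ∈ Ioo c d) :
    0 ≤ a x := by
  rcases eq_or_ne x 1 with rfl | h
  · exact a.map_one.ge
  · exact (a.pos x (Ioo_subset_Icc_self hx) h).le

theorem spaceDeriv_spec {u : L2 c d} (hu : FiniteNorm a u) :
    HasWeakDerivOn (Ioo c d \ {1}) u (spaceDeriv u) ∧
      IntegrableOn (fun x => a x * spaceDeriv u x ^ 2) (Ioo c d) := by
  obtain ⟨g, hg, hi⟩ := hu
  refine ⟨hasWeakDerivOn_weakDeriv ⟨g, hg⟩, hi.congr ?_⟩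
  have := weakDeriv_ae (isOpen_punctured c d) hg
  rw [restrict_punctured] at this
  filter_upwards [this] with x hx
  rw [spaceDeriv, hx]

theorem integrable_energy {u w : L2 c d} (hu : FiniteNorm a u) (hw : FiniteNorm a w) :
    IntegrableOn (fun x => a x * (spaceDeriv u x * spaceDeriv w x)) (Ioo c d) := by
  obtain ⟨h1, i1⟩ := spaceDeriv_spec hu
  obtain ⟨h2, i2⟩ := spaceDeriv_spec hw
  have m1 := h1.2.1.aestronglyMeasurable
  have m2 := h2.2.1.aestronglyMeasurable
  rw [restrict_punctured] at m1 m2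
  have m3 : AEStronglyMeasurable a (volume.restrict (Ioo c d)) :=
    (a.continuousOn.mono Ioo_subset_Icc_self).aestronglyMeasurable measurableSet_Ioo
  refine Integrable.mono' (i1.add i2) (m3.mul (m1.mul m2)) ?_
  filter_upwards [ae_restrict_mem measurableSet_Ioo] with x hx
  have ha := a.nonneg hx
  simp only [Pi.add_apply, Real.norm_eq_abs, abs_mul, abs_of_nonneg ha]
  rw [← mul_add]
  refine mul_le_mul_of_nonneg_left ?_ ha
  nlinarith [sq_nonneg (|spaceDeriv u x| - |spaceDeriv w x|), sq_abs (spaceDeriv u x),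
    sq_abs (spaceDeriv w x), sq_nonneg (spaceDeriv u x), sq_nonneg (spaceDeriv w x)]

theorem spaceDeriv_add {u w : L2 c d} (hu : FiniteNorm a u) (hw : FiniteNorm a w) :
    spaceDeriv (u + w) =ᵐ[volume.restrict (Ioo c d)]
      fun x => spaceDeriv u x + spaceDeriv w x := by
  have h := (spaceDeriv_spec hu).1.add (spaceDeriv_spec hw).1
  have h' := h.congr (v := (u + w : L2 c d)) (by
    rw [restrict_punctured]
    exact (Lp.coeFn_add u w).symm) (ae_eq_refl _)
  have := weakDeriv_ae (isOpen_punctured c d) h'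
  rwa [restrict_punctured] at this

theorem spaceDeriv_smul {u : L2 c d} (hu : FiniteNorm a u) (r : ℝ) :
    spaceDeriv (r • u) =ᵐ[volume.restrict (Ioo c d)] fun x => r * spaceDeriv u x := by
  have h := (spaceDeriv_spec hu).1.const_mul r
  have h' := h.congr (v := (r • u : L2 c d)) (by
    rw [restrict_punctured]
    exact (Lp.coeFn_smul r u).symm) (ae_eq_refl _)
  have := weakDeriv_ae (isOpen_punctured c d) h'
  rwa [restrict_punctured] at this

theorem ess_eq_of_ae_const {f : ℝ → ℝ} {p q k : ℝ} {l : Filter ℝ} [(l ⊓ ae volume).NeBot]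
    (h : f =ᵐ[volume.restrict (Ioo p q)] fun _ => k) (hl : Ioo p q ∈ l)
    (ht : Tendsto f (l ⊓ ae volume) (𝓝 0)) : k = 0 := by
  have h1 : f =ᶠ[l ⊓ ae volume] fun _ => k := by
    have h2 := (ae_restrict_iff' measurableSet_Ioo).1 h
    filter_upwards [mem_inf_of_left hl, mem_inf_of_right h2] with x hx hx2
    exact hx2 hx
  exact tendsto_nhds_unique (tendsto_const_nhds.congr' h1.symm) ht

theorem neBot_right (p : ℝ) : (𝓝[>] p ⊓ ae (volume : Measure ℝ)).NeBot := by
  rw [inf_comm, inf_neBot_iff_frequently_left]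
  intro P hP
  rw [frequently_iff]
  intro U hU
  obtain ⟨q, hq, hU⟩ := mem_nhdsGT_iff_exists_Ioo_subset.1 hU
  by_contra hcon
  push Not at hcon
  have : volume (Ioo p q) = 0 := by
    refine measure_mono_null (fun x hx => ?_) (ae_iff.1 hP)
    exact hcon x (hU hx)
  rw [Real.volume_Ioo] at this
  simp only [ENNReal.ofReal_eq_zero] at this
  exact absurd (mem_Ioi.1 hq) (not_lt.2 (by linarith))

theorem neBot_left (p : ℝ) : (𝓝[<] p ⊓ ae (volume : Measure ℝ)).NeBot := by
  rw [inf_comm, inf_neBot_iff_frequently_left]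
  intro P hP
  rw [frequently_iff]
  intro U hU
  obtain ⟨q, hq, hU⟩ := mem_nhdsLT_iff_exists_Ioo_subset.1 hU
  by_contra hcon
  push Not at hcon
  have : volume (Ioo q p) = 0 := by
    refine measure_mono_null (fun x hx => ?_) (ae_iff.1 hP)
    exact hcon x (hU hx)
  rw [Real.volume_Ioo] at this
  simp only [ENNReal.ofReal_eq_zero] at this
  exact absurd (mem_Iio.1 hq) (not_lt.2 (by linarith))

theorem finiteNorm_of_mem_W10 {u : L2 c d} (hu : u ∈ W10 a) : FiniteNorm a u := by
  obtain ⟨⟨g, h1, h2, -⟩, -⟩ := hu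
  exact ⟨g, h1, h2⟩

theorem eq_zero_of_energy_zero {u : L2 c d} (hu : u ∈ W10 a)
    (h0 : ∫ x in Ioo c d, a x * (spaceDeriv u x * spaceDeriv u x) = 0) : u = 0 := by
  have hf := finiteNorm_of_mem_W10 hu
  have h1 := (spaceDeriv_spec hf).1
  have hz : spaceDeriv u =ᵐ[volume.restrict (Ioo c d)] fun _ => (0 : ℝ) := by
    have e := (setIntegral_eq_zero_iff_of_nonneg_ae (by
      filter_upwards [ae_restrict_mem measurableSet_Ioo] with x hx
      exact mul_nonneg (a.nonneg hx) (mul_self_nonneg _)) (integrable_energy hf hf)).1 h0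
    have hne : ∀ᵐ x ∂(volume.restrict (Ioo c d) : Measure ℝ), x ≠ 1 :=
      ae_restrict_of_ae (by simp [ae_iff])
    filter_upwards [e, hne, ae_restrict_mem measurableSet_Ioo] with x hx h2 h3
    have ha := a.pos x (Ioo_subset_Icc_self h3) h2
    simpa [ha.ne'] using hx
  have h2 : HasWeakDerivOn (Ioo c d \ {1}) u (fun _ => 0) :=
    h1.congr (ae_eq_refl _) (by rwa [restrict_punctured])
  have hl : Ioo c 1 ⊆ Ioo c d \ {1} := fun x hx =>
    ⟨⟨hx.1, hx.2.trans a.one_lt_d⟩, hx.2.ne⟩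
  have hr : Ioo 1 d ⊆ Ioo c d \ {1} := fun x hx =>
    ⟨⟨a.c_lt_one.trans hx.1, hx.2⟩, hx.1.ne'⟩
  obtain ⟨k₁, hk₁⟩ := (h2.mono hl).ae_const a.c_lt_one
  obtain ⟨k₂, hk₂⟩ := (h2.mono hr).ae_const a.one_lt_d
  have n₁ := neBot_right c
  have n₂ := neBot_left d
  have z₁ : k₁ = 0 := ess_eq_of_ae_const hk₁ (Ioo_mem_nhdsGT a.c_lt_one) hu.2.1
  have z₂ : k₂ = 0 := ess_eq_of_ae_const hk₂ (Ioo_mem_nhdsLT a.one_lt_d) hu.2.2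
  subst z₁
  subst z₂
  refine Lp.ext ?_
  refine EventuallyEq.trans ?_ (Lp.coeFn_zero ℝ 2 _).symm
  have hcov : (Ioo c d \ {1} : Set ℝ) ⊆ Ioo c 1 ∪ Ioo 1 d := fun x hx =>
    (lt_or_gt_of_ne hx.2).elim (fun h => Or.inl ⟨hx.1.1, h⟩) fun h => Or.inr ⟨h, hx.1.2⟩
  have hae : ∀ᵐ x ∂(volume.restrict (Ioo c d \ {1}) : Measure ℝ), u x = 0 := by
    refine ae_restrict_of_ae_restrict_of_subset hcov ?_
    exact (ae_restrict_union_iff _ _ _).2 ⟨hk₁, hk₂⟩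
  rwa [restrict_punctured] at hae

/-- The space `V` as a type of its own; its norm is that of the scalar product `∫ a u_x w_x`. -/
structure EnergySpace (V : IntermediateSpace a) where
  toSub : V.carrier

namespace EnergySpace

variable {V : IntermediateSpace a}

/-- The element of `L²(c, d)` underlying an element of `V`. -/
def toL2 (u : EnergySpace V) : L2 c d := u.toSub

/-- The obvious bijection with the subspace. -/
def equiv (V : IntermediateSpace a) : EnergySpace V ≃ V.carrier :=
  ⟨toSub, mk, fun _ => rfl, fun _ => rfl⟩

instance : AddCommGroup (EnergySpace V) := (equiv V).addCommGroup

instance : Module ℝ (EnergySpace V) := (equiv V).module ℝ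

theorem mem_W10 (u : EnergySpace V) : u.toL2 ∈ W10 a := V.subset_W10 u.toSub.2

theorem finiteNorm (u : EnergySpace V) : FiniteNorm a u.toL2 := finiteNorm_of_mem_W10 u.mem_W10

/-- The scalar product `⟨u, w⟩ = ∫ a u_x w_x` on `V`. -/
@[reducible] def core (V : IntermediateSpace a) : InnerProductSpace.Core ℝ (EnergySpace V) where
  inner u w := ∫ x in Ioo c d, a x * (spaceDeriv u.toL2 x * spaceDeriv w.toL2 x)
  conj_inner_symm u w := by
    simp only [conj_trivial]
    congr 1
    ext x
    ring
  re_inner_nonneg u := by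
    simp only [RCLike.re_to_real]
    exact setIntegral_nonneg measurableSet_Ioo fun x hx =>
      mul_nonneg (a.nonneg hx) (mul_self_nonneg _)
  add_left u v w := by
    rw [← integral_add (integrable_energy u.finiteNorm w.finiteNorm)
      (integrable_energy v.finiteNorm w.finiteNorm)]
    refine integral_congr_ae ?_
    filter_upwards [spaceDeriv_add u.finiteNorm v.finiteNorm] with x hx
    change a x * (spaceDeriv (u.toL2 + v.toL2) x * _) = _
    rw [hx]
    ring
  smul_left u w r := by
    simp only [conj_trivial]
    rw [← integral_const_mul]
    refine integral_congr_ae ?_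
    filter_upwards [spaceDeriv_smul u.finiteNorm r] with x hx
    change a x * (spaceDeriv (r • u.toL2) x * _) = _
    rw [hx]
    ring
  definite u h := by
    have h1 : u.toL2 = 0 := eq_zero_of_energy_zero u.mem_W10 h
    exact (equiv V).injective (Subtype.ext h1)

instance : NormedAddCommGroup (EnergySpace V) := (core V).toNormedAddCommGroup

instance : InnerProductSpace ℝ (EnergySpace V) := InnerProductSpace.ofCore (core V).toCore

theorem inner_def (u w : EnergySpace V) : inner ℝ u w =
    ∫ x in Ioo c d, a x * (spaceDeriv u.toL2 x * spaceDeriv w.toL2 x) := rfl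

end EnergySpace

/-- The space `𝓗_a = V × L²(c, d)` with scalar product `∫ a u_x w_x + ∫ v z`. -/
abbrev StateSpace (V : IntermediateSpace a) : Type := WithLp 2 (EnergySpace V × L2 c d)

/-! ## The wave operator with transmission conditions -/

/-- The domain of the wave operator: `u ∈ V ∩ W²_a` (so that `u(c) = u(d) = 0`) and `v ∈ V`, with
* for a weak degeneration, `u(1-) = u(1+)` and `(a u_x)(1-) = (a u_x)(1+)`;
* for a strong degeneration, `(a φ_x u)(1-) = 0 = (a φ_x u)(1+)` for all `φ ∈ H²_a` and
  `(a u_x)(1-) = 0 = (a u_x)(1+)`. -/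
structure InDomain (V : IntermediateSpace a) (U : StateSpace V) : Prop where
  fst_mem : U.fst.toL2 ∈ W2 a
  snd_mem : U.snd ∈ V.carrier
  weak : a.IsWeak →
    (∃ l, EssTendstoLeft U.fst.toL2 1 l ∧ EssTendstoRight U.fst.toL2 1 l) ∧
    (∃ l, EssTendstoLeft (flux a U.fst.toL2) 1 l ∧ EssTendstoRight (flux a U.fst.toL2) 1 l)
  strong : ¬ a.IsWeak →
    (∀ φ ∈ H2 a, EssTendstoLeft (fun x => flux a φ x * U.fst.toL2 x) 1 0 ∧
      EssTendstoRight (fun x => flux a φ x * U.fst.toL2 x) 1 0) ∧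
    (EssTendstoLeft (flux a U.fst.toL2) 1 0 ∧ EssTendstoRight (flux a U.fst.toL2) 1 0)

/-- The graph of the wave operator `A (u, v) = (v, (a u_x)_x)`: `U ∈ D(A)` and `F = A U`. -/
def WaveOperator (V : IntermediateSpace a) (U F : StateSpace V) : Prop :=
  InDomain V U ∧ F.fst.toL2 = U.snd ∧
    F.snd =ᵐ[volume.restrict (Ioo c d)] weakDeriv (Ioo c d) (flux a U.fst.toL2)

/-! ## Semigroups and mild solutions -/

/-- `S t`, `t ≥ 0`, is a strongly continuous semigroup of bounded linear operators. (The values at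
`t < 0` are irrelevant.) -/
structure IsC0Semigroup {E : Type*} [NormedAddCommGroup E] [NormedSpace ℝ E]
    (S : ℝ → E →L[ℝ] E) : Prop where
  zero : S 0 = ContinuousLinearMap.id ℝ E
  add : ∀ s t, 0 ≤ s → 0 ≤ t → S (s + t) = (S s).comp (S t)
  continuousOn : ∀ x, ContinuousOn (fun t => S t x) (Ici 0)

/-- The operator with graph `A` is the infinitesimal generator of `S`: `x ∈ D(A)` and `A x = y` if
and only if `(S h x - x) / h → y` as `h ↓ 0`. -/
def IsGenerator {E : Type*} [NormedAddCommGroup E] [NormedSpace ℝ E]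
    (A : E → E → Prop) (S : ℝ → E →L[ℝ] E) : Prop :=
  ∀ x y, A x y ↔ Tendsto (fun h : ℝ => h⁻¹ • (S h x - x)) (𝓝[>] 0) (𝓝 y)

/-- `y ∈ C([0, ∞); V) ∩ C¹([0, ∞); L²(c, d))` is the mild solution with data `y(0) = y₀`,
`y_t(0) = y₁`: the first component of `e^{tA} (y₀, y₁)`, with `e^{tA}` the strongly continuous
semigroup generated by the wave operator `A`. -/
structure IsMildSolution (V : IntermediateSpace a) (y₀ : EnergySpace V) (y₁ : L2 c d)
    (y : ℝ → EnergySpace V) : Prop where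
  continuousOn : ContinuousOn y (Ici 0)
  contDiffOn : ContDiffOn ℝ 1 (fun t => (y t).toL2) (Ici 0)
  orbit : ∃ S : ℝ → StateSpace V →L[ℝ] StateSpace V, IsC0Semigroup S ∧
    IsGenerator (WaveOperator V) S ∧ ∀ t, 0 ≤ t → y t = (S t (WithLp.toLp 2 (y₀, y₁))).fst

/-- The time derivative `y_t` in `L²(c, d)`, one-sided at `t = 0`. -/
def timeDeriv {V : IntermediateSpace a} (y : ℝ → EnergySpace V) (t : ℝ) : L2 c d :=
  derivWithin (fun s => (y s).toL2) (Ici 0) t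

/-- The energy `½ ∫ (y_t² + a y_x²)` over `(c, d) ∖ {1}`. -/
def energy {V : IntermediateSpace a} (y : ℝ → EnergySpace V) (t : ℝ) : ℝ :=
  1 / 2 * ∫ x in Ioo c d \ {1}, (timeDeriv y t x ^ 2 + a x * spaceDeriv (y t).toL2 x ^ 2)

end Energy

end

/-! ## Strongly continuous semigroups -/

namespace IsC0Semigroup

variable {E : Type*} [NormedAddCommGroup E] [NormedSpace ℝ E] {S : ℝ → E →L[ℝ] E}

/-! The energy is half the squared norm of the orbit in the state space, and the wave operator is
skew-symmetric: `⟨U, A U⟩ = ∫ (a u_x v_x + (a u_x)_x v) = 0`. Along an orbit that starts in the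
domain the squared norm therefore has right derivative zero. The domain is dense, so every `S t`, `t
≥ 0`, is an isometry (`IsC0Semigroup.norm_apply`).

Skew-symmetry is an integration by parts (`WaveOperator.inner_eq_zero`). If the degeneration is
weak, `v` and the flux `a u_x` are both absolutely continuous across `1`, and `v` vanishes at `c`
and `d`. If it is strong, `v` may blow up at `1`. There the flux vanishes at `1` and has a square
integrable derivative, so it is `O(√|x - 1|)`. A nonzero limit of flux times `v` would force `v² ≥
const / |x - 1|` near `1`, against `v ∈ L²` (`integral_by_parts_of_tendsto_zero`).

Two analytic facts make the semigroup argument available. The lower bound on `|(√a)'|` gives `(x -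
1)² ≤ C a`, and Hardy's inequality on either side of `1` then gives Poincaré's inequality
(`exists_poincare`). So `V` embeds continuously in `L²`, and with the closedness of `V` in `‖·‖_a`
it is complete (`EnergySpace.completeSpace`). Completeness allows time integrals of orbits. The
embedding is what identifies `y_t` with the second component of the orbit for arbitrary data, not
only for data in the domain (`IsC0Semigroup.hasDerivWithinAt_comp`). -/

theorem continuous_max (hS : IsC0Semigroup S) (x : E) : Continuous fun t => S (max t 0) x :=
  (hS.continuousOn x).comp_continuous (continuous_id.max continuous_const) fun t => le_max_right t 0

/-- Freezing the orbit at its initial value for negative times makes the integrand continuous on the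
whole line, so the derivative is two-sided even at `t = 0`. -/
theorem hasDerivAt_integral [CompleteSpace E] (hS : IsC0Semigroup S) (x : E) (t : ℝ) :
    HasDerivAt (fun t => ∫ s in (0 : ℝ)..t, S (max s 0) x) (S (max t 0) x) t :=
  intervalIntegral.integral_hasDerivAt_right ((hS.continuous_max x).intervalIntegrable _ _)
    ((hS.continuous_max x).stronglyMeasurableAtFilter _ _) (hS.continuous_max x).continuousAt

/-- By the semigroup law `S h` moves the window of integration from `[0, t]` to `[h, t + h]`. -/
theorem apply_integral [CompleteSpace E] (hS : IsC0Semigroup S) (x : E) {t h : ℝ} (ht : 0 ≤ t)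
    (hh : 0 ≤ h) :
    S h (∫ s in (0 : ℝ)..t, S (max s 0) x) =
      (∫ s in (0 : ℝ)..(t + h), S (max s 0) x) - ∫ s in (0 : ℝ)..h, S (max s 0) x := by
  have hi := fun p q => (hS.continuous_max x).intervalIntegrable (μ := volume) p q
  rw [← (S h).intervalIntegral_comp_comm (hi 0 t), intervalIntegral.integral_interval_sub_left
    (hi 0 (t + h)) (hi 0 h)]
  have e : ∫ s in (0 : ℝ)..t, S h (S (max s 0) x) = ∫ s in (0 : ℝ)..t, S (max (s + h) 0) x := by
    refine intervalIntegral.integral_congr fun s hs => ?_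
    rw [uIcc_of_le ht] at hs
    rw [max_eq_left hs.1, max_eq_left (by linarith [hs.1]), add_comm s h, hS.add h s hh hs.1]
    rfl
  rw [e, intervalIntegral.integral_comp_add_right (fun s => S (max s 0) x), zero_add]

/-- After the shift, the difference quotient is the mean of the orbit over `[t, t + h]` minus its
mean over `[0, h]`. This holds for every `x`, whether or not it lies in the domain. -/
theorem generator_integral [CompleteSpace E] (hS : IsC0Semigroup S) {A : E → E → Prop}
    (hA : IsGenerator A S) (x : E) {t : ℝ} (ht : 0 ≤ t) :
    A (∫ s in (0 : ℝ)..t, S (max s 0) x) (S t x - x) := by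
  rw [hA]
  have l1 := (hS.hasDerivAt_integral x t).tendsto_slope_zero_right
  have l2 := (hS.hasDerivAt_integral x 0).tendsto_slope_zero_right
  rw [max_eq_left ht] at l1
  rw [max_self, hS.zero] at l2
  refine (l1.sub l2).congr' ?_
  filter_upwards [self_mem_nhdsWithin] with h hh
  rw [hS.apply_integral x ht (le_of_lt hh), ← smul_sub]
  congr 1
  simp only [zero_add, intervalIntegral.integral_same]
  abel

/-- Density of the domain: the means of the orbit over `[0, h]` lie in it and tend to `x`. -/
theorem exists_generator_tendsto [CompleteSpace E] (hS : IsC0Semigroup S) {A : E → E → Prop}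
    (hA : IsGenerator A S) (x : E) : ∃ f : ℝ → E, Tendsto f (𝓝[>] 0) (𝓝 x) ∧
      ∀ᶠ h in 𝓝[>] 0, ∃ y, A (f h) y := by
  refine ⟨fun h => h⁻¹ • ∫ s in (0 : ℝ)..h, S (max s 0) x, ?_, ?_⟩
  · have l2 := (hS.hasDerivAt_integral x 0).tendsto_slope_zero_right
    simpa [hS.zero] using l2
  · filter_upwards [self_mem_nhdsWithin] with h hh
    refine ⟨h⁻¹ • (S h x - x), (hA _ _).2 ?_⟩
    have := ((hA _ _).1 (hS.generator_integral hA x (le_of_lt hh))).const_smul h⁻¹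
    refine this.congr fun k => ?_
    rw [map_smul, ← smul_sub, smul_comm]

/-- `S t` is continuous and commutes with the difference quotients that define the generator. -/
theorem generator_apply (hS : IsC0Semigroup S) {A : E → E → Prop} (hA : IsGenerator A S)
    {x y : E} (hxy : A x y) {t : ℝ} (ht : 0 ≤ t) : A (S t x) (S t y) := by
  rw [hA] at hxy ⊢
  refine (((S t).continuous.tendsto y).comp hxy).congr' ?_
  filter_upwards [self_mem_nhdsWithin] with h hh
  have e1 : S t (S h x) = S (t + h) x := by rw [hS.add t h ht (le_of_lt hh)]; rfl
  have e2 : S h (S t x) = S (t + h) x := by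
    rw [add_comm, hS.add h t (le_of_lt hh) ht]; rfl
  simp only [Function.comp_apply, map_smul, map_sub, e1, e2]

/-- The right derivative is enough for its use: a continuous function with vanishing right
derivative is constant. -/
theorem hasDerivWithinAt_right (hS : IsC0Semigroup S) {A : E → E → Prop} (hA : IsGenerator A S)
    {x y : E} (hxy : A x y) {t : ℝ} (ht : 0 ≤ t) :
    HasDerivWithinAt (fun s => S s x) (S t y) (Ici t) t := by
  have h := (hA _ _).1 (hS.generator_apply hA hxy ht)
  rw [← hasDerivWithinAt_Ioi_iff_Ici, hasDerivWithinAt_iff_tendsto_slope' (by simp)]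
  have hm : Tendsto (fun s => s - t) (𝓝[>] t) (𝓝[>] 0) := by
    refine tendsto_nhdsWithin_iff.2 ⟨?_, ?_⟩
    · have : Tendsto (fun s => s - t) (𝓝 t) (𝓝 (t - t)) := tendsto_id.sub_const t
      rw [sub_self] at this
      exact this.mono_left nhdsWithin_le_nhds
    · filter_upwards [self_mem_nhdsWithin] with s hs
      exact sub_pos.2 (mem_Ioi.1 hs)
  refine (h.comp hm).congr' ?_
  filter_upwards [self_mem_nhdsWithin] with s hs
  have e : S (s - t) (S t x) = S s x := by
    rw [show S s = S ((s - t) + t) by rw [sub_add_cancel],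
      hS.add (s - t) t (sub_nonneg.2 (le_of_lt hs)) ht]
    rfl
  simp only [Function.comp_apply, e, slope, vsub_eq_sub]

/-- If `P (A x) = Q x` on the domain of the generator, then `P (S t x)` is differentiable in time
with derivative `Q (S t x)` for every `x`. -/
theorem hasDerivWithinAt_comp [CompleteSpace E] (hS : IsC0Semigroup S) {A : E → E → Prop}
    (hA : IsGenerator A S) {F : Type*} [NormedAddCommGroup F] [NormedSpace ℝ F] (P Q : E →L[ℝ] F)
    (hPQ : ∀ x y, A x y → P y = Q x) (x : E) {t : ℝ} (ht : 0 ≤ t) :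
    HasDerivWithinAt (fun s => P (S s x)) (Q (S t x)) (Ici 0) t := by
  have h1 := ((Q.hasFDerivAt.comp_hasDerivAt t (hS.hasDerivAt_integral x t)).const_add
    (P x)).hasDerivWithinAt (s := Ici 0)
  rw [max_eq_left ht] at h1
  -- The time integral of the orbit is in the domain and is mapped to `S s x - x`; applying `P A =
  -- Q` to it turns `P (S s x)` into a constant plus a primitive.
  have e : ∀ s ∈ Ici (0 : ℝ), P (S s x) = P x + Q (∫ r in (0 : ℝ)..s, S (max r 0) x) := by
    intro s hs
    rw [← hPQ _ _ (hS.generator_integral hA x hs), map_sub]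
    abel
  exact h1.congr e (e t ht)

end IsC0Semigroup

/-- The semigroup of a skew-symmetric generator is isometric. -/
theorem IsC0Semigroup.norm_apply {E : Type*} [NormedAddCommGroup E] [InnerProductSpace ℝ E]
    [CompleteSpace E] {S : ℝ → E →L[ℝ] E} (hS : IsC0Semigroup S) {A : E → E → Prop}
    (hA : IsGenerator A S) (hskew : ∀ x y, A x y → inner ℝ x y = 0) (x : E) {t : ℝ} (ht : 0 ≤ t) :
    ‖S t x‖ = ‖x‖ := by
  have key : ∀ x y, A x y → ‖S t x‖ = ‖x‖ := by
    intro x y hxy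
    have hc : ContinuousOn (fun s => ‖S s x‖ ^ 2) (Icc 0 t) :=
      (((hS.continuousOn x).mono Icc_subset_Ici_self).norm).pow 2
    -- The derivative is `2 ⟨S s x, S s y⟩`, where `S s y` is the image of `S s x` under the
    -- generator.
    have hd : ∀ s ∈ Ico 0 t, HasDerivWithinAt (fun s => ‖S s x‖ ^ 2) 0 (Ici s) s := by
      intro s hs
      have := (hS.hasDerivWithinAt_right hA hxy hs.1).norm_sq
      rwa [hskew _ _ (hS.generator_apply hA hxy hs.1), mul_zero] at this
    have := constant_of_has_deriv_right_zero hc hd t (right_mem_Icc.2 ht)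
    rw [hS.zero, ContinuousLinearMap.id_apply] at this
    exact (sq_eq_sq₀ (norm_nonneg _) (norm_nonneg _)).1 this
  obtain ⟨f, hf, hd⟩ := hS.exists_generator_tendsto hA x
  have l1 := (((S t).continuous.tendsto x).comp hf).norm
  refine tendsto_nhds_unique (l1.congr' ?_) hf.norm
  filter_upwards [hd] with h hh
  obtain ⟨y, hy⟩ := hh
  exact key _ y hy

/-! ## Absolutely continuous representatives -/

theorem MeasureTheory.IntegrableOn.intervalIntegrable_Ioo {p q x y : ℝ} {g : ℝ → ℝ} (hpq : p ≤ q)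
    (hg : IntegrableOn g (Ioo p q)) (hx : x ∈ Icc p q) (hy : y ∈ Icc p q) :
    IntervalIntegrable g volume x y := by
  have h : IntervalIntegrable g volume p q := by
    rwa [intervalIntegrable_iff_integrableOn_Ioo_of_le hpq]
  refine h.mono_set ?_
  rw [uIcc_of_le hpq]
  exact uIcc_subset_Icc hx hy

theorem continuousOn_integral_Icc {p q : ℝ} {g : ℝ → ℝ} (hpq : p ≤ q)
    (hg : IntegrableOn g (Ioo p q)) : ContinuousOn (fun x => ∫ t in p..x, g t) (Icc p q) := by
  have := intervalIntegral.continuousOn_primitive_interval (μ := volume) (a := p) (b := q) (f := g)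
    (by rwa [uIcc_of_le hpq, integrableOn_Icc_iff_integrableOn_Ioo])
  rwa [uIcc_of_le hpq] at this

/-- Integration by parts for primitives of integrable functions. -/
theorem integral_mul_add_mul_primitive {p q k l : ℝ} {f g : ℝ → ℝ}
    (hf : IntervalIntegrable f volume p q) (hg : IntervalIntegrable g volume p q) :
    ∫ x in p..q, (f x * (l + ∫ t in p..x, g t) + (k + ∫ t in p..x, f t) * g x) =
      (k + ∫ t in p..q, f t) * (l + ∫ t in p..q, g t) - k * l := by
  have key : ∀ {h : ℝ → ℝ} {m : ℝ}, IntervalIntegrable h volume p q →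
      AbsolutelyContinuousOnInterval (fun x => m + ∫ t in p..x, h t) p q ∧
      ∀ᵐ x, x ∈ uIcc p q → deriv (fun x => m + ∫ t in p..x, h t) x = h x := by
    intro h m hh
    constructor
    · exact (ContDiffOn.absolutelyContinuousOnInterval contDiffOn_const).fun_add
        (hh.absolutelyContinuousOnInterval_intervalIntegral (by simp))
    · filter_upwards [hh.ae_hasDerivAt_integral] with x hx hx'
      exact ((hx hx' p (by simp)).const_add m).deriv
  obtain ⟨c1, d1⟩ := key (m := k) hf
  obtain ⟨c2, d2⟩ := key (m := l) hg
  have := c1.integral_deriv_mul_eq_sub c2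
  simp only [intervalIntegral.integral_same, add_zero] at this
  rw [← this]
  refine intervalIntegral.integral_congr_ae ?_
  filter_upwards [d1, d2] with x h1 h2 hx
  rw [h1 (uIoc_subset_uIcc hx), h2 (uIoc_subset_uIcc hx)]

/-- A test function vanishes at both end points, so it is the primitive of its derivative and
integration by parts leaves no boundary terms. -/
theorem hasWeakDerivOn_primitive {p q : ℝ} {g : ℝ → ℝ} (hpq : p < q)
    (hg : IntegrableOn g (Ioo p q)) :
    HasWeakDerivOn (Ioo p q) (fun x => ∫ t in p..x, g t) g := by
  refine ⟨?_, hg.locallyIntegrableOn, fun φ h1 h2 h3 => ?_⟩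
  · exact ((continuousOn_integral_Icc hpq.le hg).mono Ioo_subset_Icc_self).locallyIntegrableOn
      measurableSet_Ioo
  have hd : Continuous (deriv φ) := h1.continuous_deriv (by simp)
  have hii := hg.intervalIntegrable_Ioo hpq.le (left_mem_Icc.2 hpq.le) (right_mem_Icc.2 hpq.le)
  have hz : ∀ x, x ∉ Ioo p q → φ x = 0 := fun x hx =>
    image_eq_zero_of_notMem_tsupport fun h => hx (h3 h)
  have hφ : ∀ x, ∫ t in p..x, deriv φ t = φ x := by
    intro x
    rw [intervalIntegral.integral_deriv_eq_sub (fun y _ => (h1.differentiable (by simp)) y)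
      (hd.intervalIntegrable _ _), hz p (by simp), sub_zero]
  have e := integral_mul_add_mul_primitive (k := 0) (l := 0) hii (hd.intervalIntegrable p q)
  simp only [hφ, zero_add, hz q (by simp), mul_zero, sub_zero] at e
  have i1 : IntervalIntegrable (fun x => g x * φ x) volume p q :=
    hii.mul_continuousOn h1.continuous.continuousOn
  have i2 : IntervalIntegrable (fun x => (∫ t in p..x, g t) * deriv φ x) volume p q := by
    refine ContinuousOn.intervalIntegrable ?_
    rw [uIcc_of_le hpq.le]
    exact (continuousOn_integral_Icc hpq.le hg).mul hd.continuousOn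
  rw [intervalIntegral.integral_add i1 i2, intervalIntegral.integral_of_le hpq.le,
    intervalIntegral.integral_of_le hpq.le, integral_Ioc_eq_integral_Ioo,
    integral_Ioc_eq_integral_Ioo] at e
  linarith

/-- The difference between `u` and the primitive has weak derivative zero. -/
theorem HasWeakDerivOn.ae_eq_primitive {p q : ℝ} {u g : ℝ → ℝ} (hpq : p < q)
    (h : HasWeakDerivOn (Ioo p q) u g) (hg : IntegrableOn g (Ioo p q)) :
    ∃ k : ℝ, u =ᵐ[volume.restrict (Ioo p q)] fun x => k + ∫ t in p..x, g t := by
  have h0 := h.add ((hasWeakDerivOn_primitive hpq hg).const_mul (-1))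
  obtain ⟨k, hk⟩ := HasWeakDerivOn.ae_const hpq
    (h0.congr (ae_eq_refl _) (h := fun _ => 0) (ae_of_all _ fun x => by ring))
  refine ⟨k, ?_⟩
  filter_upwards [hk] with x hx
  linarith

theorem EssTendstoRight.congr_Ioo {u v : ℝ → ℝ} {p q l : ℝ} (hpq : p < q)
    (h : EssTendstoRight u p l) (huv : u =ᵐ[volume.restrict (Ioo p q)] v) :
    EssTendstoRight v p l := by
  refine Tendsto.congr' ?_ h
  have h2 := (ae_restrict_iff' measurableSet_Ioo).1 huv
  filter_upwards [mem_inf_of_left (Ioo_mem_nhdsGT hpq), mem_inf_of_right h2] with x hx hx2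
  exact hx2 hx

theorem EssTendstoLeft.congr_Ioo {u v : ℝ → ℝ} {p q l : ℝ} (hpq : p < q)
    (h : EssTendstoLeft u q l) (huv : u =ᵐ[volume.restrict (Ioo p q)] v) :
    EssTendstoLeft v q l := by
  refine Tendsto.congr' ?_ h
  have h2 := (ae_restrict_iff' measurableSet_Ioo).1 huv
  filter_upwards [mem_inf_of_left (Ioo_mem_nhdsLT hpq), mem_inf_of_right h2] with x hx hx2
  exact hx2 hx

theorem EssTendstoRight.eq_of_continuousOn {u : ℝ → ℝ} {p q l : ℝ} (hpq : p < q)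
    (h : EssTendstoRight u p l) (hu : ContinuousOn u (Icc p q)) : u p = l := by
  have := neBot_right p
  refine tendsto_nhds_unique (f := u) (l := 𝓝[>] p ⊓ ae volume) ?_ h
  refine Tendsto.mono_left ?_ (inf_le_left)
  have h1 := hu p (left_mem_Icc.2 hpq.le)
  rw [ContinuousWithinAt, nhdsWithin_Icc_eq_nhdsGE hpq] at h1
  exact h1.mono_left (nhdsWithin_mono _ Ioi_subset_Ici_self)

theorem EssTendstoLeft.eq_of_continuousOn {u : ℝ → ℝ} {p q l : ℝ} (hpq : p < q)
    (h : EssTendstoLeft u q l) (hu : ContinuousOn u (Icc p q)) : u q = l := by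
  have := neBot_left q
  refine tendsto_nhds_unique (f := u) (l := 𝓝[<] q ⊓ ae volume) ?_ h
  refine Tendsto.mono_left ?_ (inf_le_left)
  have h1 := hu q (right_mem_Icc.2 hpq.le)
  rw [ContinuousWithinAt, nhdsWithin_Icc_eq_nhdsLE hpq] at h1
  exact h1.mono_left (nhdsWithin_mono _ Iio_subset_Iic_self)

/-- A function that vanishes at the left end point is the primitive of its weak derivative, even if
the latter is not integrable up to the right end point. -/
theorem HasWeakDerivOn.ae_eq_primitive_of_tendsto_zero {p q : ℝ} {u g : ℝ → ℝ}
    (h : HasWeakDerivOn (Ioo p q) u g) (h0 : EssTendstoRight u p 0)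
    (hg : ∀ x ∈ Ioo p q, IntegrableOn g (Ioo p x)) :
    u =ᵐ[volume.restrict (Ioo p q)] fun x => ∫ t in p..x, g t := by
  have key : ∀ x ∈ Ioo p q, u =ᵐ[volume.restrict (Ioo p x)] fun x => ∫ t in p..x, g t := by
    intro x hx
    obtain ⟨k, hk⟩ := (h.mono (Ioo_subset_Ioo_right hx.2.le)).ae_eq_primitive hx.1 (hg x hx)
    have hc := (continuousOn_integral_Icc hx.1.le (hg x hx)).const_add k
    have := (h0.congr_Ioo hx.1 hk).eq_of_continuousOn hx.1 hc
    simp only [intervalIntegral.integral_same, add_zero] at this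
    simpa only [this, zero_add] using hk
  rcases le_or_gt q p with hqp | hpq
  · simp [Ioo_eq_empty_of_le hqp, EventuallyEq]
  -- A countable exhaustion of `(p, q)` is needed to collect the almost everywhere statements.
  obtain ⟨s, -, hs, hl⟩ := exists_seq_strictMono_tendsto' hpq
  have hcov : Ioo p q ⊆ ⋃ n, Ioo p (s n) := by
    intro x hx
    obtain ⟨n, hn⟩ := (hl.eventually (lt_mem_nhds hx.2)).exists
    exact mem_iUnion.2 ⟨n, hx.1, hn⟩
  refine ae_restrict_of_ae_restrict_of_subset hcov ?_
  exact (ae_restrict_iUnion_iff _ _).2 fun n => key _ (hs n)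

/-- On `(p, x)` the weight is at least `(q - x)² > 0`, so `g` is square integrable there, and `|g| ≤
1 + g²`. -/
theorem integrableOn_of_sq_weight {p q x : ℝ} {g : ℝ → ℝ} (hx : x ∈ Ioo p q)
    (hm : LocallyIntegrableOn g (Ioo p q))
    (hg : IntegrableOn (fun s => (q - s) ^ 2 * g s ^ 2) (Ioo p q)) : IntegrableOn g (Ioo p x) := by
  have hsub : Ioo p x ⊆ Ioo p q := Ioo_subset_Ioo_right hx.2.le
  have hq : 0 < q - x := sub_pos.2 hx.2
  have h1 : IntegrableOn (fun s => 1 + ((q - x) ^ 2)⁻¹ * ((q - s) ^ 2 * g s ^ 2)) (Ioo p x) :=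
    (integrableOn_const (by simp)).add ((hg.mono_set hsub).const_mul _)
  refine Integrable.mono' h1 (hm.aestronglyMeasurable.mono_set hsub) ?_
  filter_upwards [ae_restrict_mem measurableSet_Ioo] with s hs
  have h2 : g s ^ 2 ≤ ((q - x) ^ 2)⁻¹ * ((q - s) ^ 2 * g s ^ 2) := by
    rw [← mul_assoc]
    refine le_mul_of_one_le_left (sq_nonneg _) ?_
    rw [inv_mul_eq_div, one_le_div (by positivity)]
    have := hs.2
    gcongr
  rw [Real.norm_eq_abs]
  nlinarith [sq_nonneg (|g s| - 1), sq_abs (g s), sq_nonneg (g s)]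

/-! ## Hardy's inequality -/

/-- With `G` the primitive representative of `u`, integrate the derivative of `(q - s) G²` over `(p,
x)`: the boundary term vanishes at `p` and is nonnegative at `x`. Absorb the cross term, then let
`x` tend to `q`, up to which `g` itself need not be integrable. -/
theorem integral_sq_le_of_tendsto_zero {p q : ℝ} {u g : ℝ → ℝ} (hpq : p < q)
    (h : HasWeakDerivOn (Ioo p q) u g) (h0 : EssTendstoRight u p 0)
    (hu : IntegrableOn (fun s => u s ^ 2) (Ioo p q))
    (hg : IntegrableOn (fun s => (q - s) ^ 2 * g s ^ 2) (Ioo p q)) :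
    ∫ s in Ioo p q, u s ^ 2 ≤ 4 * ∫ s in Ioo p q, (q - s) ^ 2 * g s ^ 2 := by
  have hgi : ∀ x ∈ Ioo p q, IntegrableOn g (Ioo p x) := fun x hx =>
    integrableOn_of_sq_weight hx h.2.1 hg
  have hrep := h.ae_eq_primitive_of_tendsto_zero h0 hgi
  have key : ∀ x ∈ Ioo p q, ∫ s in p..x, u s ^ 2 ≤ 4 * ∫ s in Ioo p q, (q - s) ^ 2 * g s ^ 2 := by
    intro x hx
    have hsub : Ioo p x ⊆ Ioo p q := Ioo_subset_Ioo_right hx.2.le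
    set G : ℝ → ℝ := fun x => ∫ t in p..x, g t with hG
    have hii : IntervalIntegrable g volume p x :=
      (hgi x hx).intervalIntegrable_Ioo hx.1.le (left_mem_Icc.2 hx.1.le) (right_mem_Icc.2 hx.1.le)
    have hGc : ContinuousOn G (uIcc p x) := by
      rw [uIcc_of_le hx.1.le]
      exact continuousOn_integral_Icc hx.1.le (hgi x hx)
    have hac : AbsolutelyContinuousOnInterval G p x :=
      hii.absolutelyContinuousOnInterval_intervalIntegral (by simp)
    have hw : AbsolutelyContinuousOnInterval (fun s => q - s) p x :=
      ContDiffOn.absolutelyContinuousOnInterval (by fun_prop)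
    have e1 := hw.integral_deriv_mul_eq_sub (hac.fun_mul hac)
    have e2 : ∫ s in p..x, (-G s ^ 2 + 2 * (q - s) * (G s * g s)) =
        (q - x) * (G x * G x) := by
      have : G p = 0 := intervalIntegral.integral_same
      rw [this, mul_zero, mul_zero, sub_zero] at e1
      rw [← e1]
      refine intervalIntegral.integral_congr_ae ?_
      filter_upwards [hii.ae_hasDerivAt_integral] with s hs hs'
      have d1 := hs (uIoc_subset_uIcc hs') p (by simp)
      have d2 : deriv (fun x => G x * G x) s = g s * G s + G s * g s := (d1.mul d1).deriv
      have d3 : deriv (fun s => q - s) s = -1 := ((hasDerivAt_id s).const_sub q).deriv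
      rw [d2, d3]
      ring
    have i1 : IntervalIntegrable (fun s => G s ^ 2) volume p x := (hGc.pow 2).intervalIntegrable
    have i2 : IntervalIntegrable (fun s => (q - s) ^ 2 * g s ^ 2) volume p x :=
      (hg.mono_set hsub).intervalIntegrable_Ioo hx.1.le (left_mem_Icc.2 hx.1.le)
        (right_mem_Icc.2 hx.1.le)
    have i3 : IntervalIntegrable (fun s => -G s ^ 2 + 2 * (q - s) * (G s * g s)) volume p x := by
      refine (hGc.pow 2).neg.intervalIntegrable.add ?_
      exact (hii.continuousOn_mul hGc).continuousOn_mul (by fun_prop)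
    -- The gap between the integrands is `½ (G - 2 (q - s) g)²`; with the sign of the boundary term
    -- this yields the factor `4`.
    have e3 : ∫ s in p..x, (-G s ^ 2 + 2 * (q - s) * (G s * g s)) ≤
        ∫ s in p..x, (-(1 / 2) * G s ^ 2 + 2 * ((q - s) ^ 2 * g s ^ 2)) := by
      refine intervalIntegral.integral_mono_on hx.1.le i3
        ((i1.const_mul _).add (i2.const_mul _)) fun s _ => ?_
      nlinarith [sq_nonneg (G s - 2 * ((q - s) * g s))]
    rw [intervalIntegral.integral_add (i1.const_mul _) (i2.const_mul _),
      intervalIntegral.integral_const_mul, intervalIntegral.integral_const_mul, e2] at e3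
    have e4 : ∫ s in p..x, u s ^ 2 = ∫ s in p..x, G s ^ 2 := by
      rw [intervalIntegral.integral_of_le hx.1.le, intervalIntegral.integral_of_le hx.1.le,
        integral_Ioc_eq_integral_Ioo, integral_Ioc_eq_integral_Ioo]
      refine integral_congr_ae ?_
      filter_upwards [ae_restrict_of_ae_restrict_of_subset hsub hrep] with s hs
      rw [hs]
    have e5 : ∫ s in p..x, (q - s) ^ 2 * g s ^ 2 ≤ ∫ s in Ioo p q, (q - s) ^ 2 * g s ^ 2 := by
      rw [intervalIntegral.integral_of_le hx.1.le, integral_Ioc_eq_integral_Ioo]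
      exact setIntegral_mono_set hg (ae_of_all _ fun s => by positivity) hsub.eventuallyLE
    have e6 : 0 ≤ (q - x) * (G x * G x) :=
      mul_nonneg (sub_nonneg.2 hx.2.le) (mul_self_nonneg _)
    rw [e4]
    linarith
  have hc := continuousOn_integral_Icc hpq.le hu q (right_mem_Icc.2 hpq.le)
  rw [ContinuousWithinAt, nhdsWithin_Icc_eq_nhdsLE hpq] at hc
  have hlim := hc.mono_left (nhdsWithin_mono _ Iio_subset_Iic_self)
  rw [intervalIntegral.integral_of_le hpq.le, integral_Ioc_eq_integral_Ioo] at hlim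
  refine le_of_tendsto hlim ?_
  filter_upwards [Ioo_mem_nhdsLT hpq] with x hx
  exact key x hx

/-! ## Vanishing boundary terms -/

/-- Instead of Cauchy–Schwarz, `2 |f| ≤ r⁻¹ + r f²` with `r = √(q - x)`, chosen so that the first
term integrates to `r`. -/
theorem abs_integral_le_sqrt {x q : ℝ} {f : ℝ → ℝ} (hxq : x < q)
    (hf : IntervalIntegrable f volume x q) (hf2 : IntervalIntegrable (fun s => f s ^ 2) volume x q) :
    |∫ s in x..q, f s| ≤ √(q - x) * (1 + ∫ s in x..q, f s ^ 2) := by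
  have hr : 0 < √(q - x) := Real.sqrt_pos.2 (sub_pos.2 hxq)
  set r := √(q - x) with hrd
  have hr2 : r * r = q - x := Real.mul_self_sqrt (sub_pos.2 hxq).le
  have h1 := intervalIntegral.abs_integral_le_integral_abs (μ := volume) (f := f) hxq.le
  have h2 : ∫ s in x..q, |f s| ≤ ∫ s in x..q, (r⁻¹ + r * f s ^ 2) := by
    refine intervalIntegral.integral_mono_on hxq.le hf.abs
      ((intervalIntegrable_const).add (hf2.const_mul r)) fun s _ => ?_
    have h3 : |f s| * 2 ≤ r⁻¹ + r * f s ^ 2 := by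
      rw [← sq_abs (f s)]
      have : 0 ≤ r⁻¹ * (r * |f s| - 1) ^ 2 := by positivity
      have e : r⁻¹ * (r * |f s| - 1) ^ 2 = r⁻¹ + r * |f s| ^ 2 - |f s| * 2 := by
        field_simp
        ring
      linarith
    linarith [abs_nonneg (f s)]
  rw [intervalIntegral.integral_add intervalIntegrable_const (hf2.const_mul r),
    intervalIntegral.integral_const_mul, intervalIntegral.integral_const, smul_eq_mul, ← hr2] at h2
  have h4 : r * r * r⁻¹ = r := by field_simp
  rw [h4] at h2
  linarith

/-- If `f ∈ W^{1,2}` vanishes at the right end point and `u ∈ L²` vanishes at the left one, then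
there are no boundary terms, although `u` may be singular at the right end point. -/
theorem integral_by_parts_of_tendsto_zero {p q : ℝ} {u g f f' : ℝ → ℝ} (hpq : p < q)
    (h : HasWeakDerivOn (Ioo p q) u g) (h0 : EssTendstoRight u p 0)
    (hu : IntegrableOn (fun s => u s ^ 2) (Ioo p q))
    (hg : ∀ x ∈ Ioo p q, IntegrableOn g (Ioo p x))
    (hf : HasWeakDerivOn (Ioo p q) f f') (hf0 : EssTendstoLeft f q 0)
    (hf' : IntegrableOn f' (Ioo p q)) (hf2 : IntegrableOn (fun s => f' s ^ 2) (Ioo p q))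
    (hi : IntegrableOn (fun s => f' s * u s + f s * g s) (Ioo p q)) :
    ∫ s in Ioo p q, (f' s * u s + f s * g s) = 0 := by
  have hrep := h.ae_eq_primitive_of_tendsto_zero h0 hg
  obtain ⟨k, hk⟩ := hf.ae_eq_primitive hpq hf'
  set G : ℝ → ℝ := fun x => ∫ t in p..x, g t with hG
  set F : ℝ → ℝ := fun x => k + ∫ t in p..x, f' t with hF
  have hFc : ContinuousOn F (Icc p q) := (continuousOn_integral_Icc hpq.le hf').const_add k
  have hFq : F q = 0 := (hf0.congr_Ioo hpq hk).eq_of_continuousOn hpq hFc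
  set K : ℝ := 1 + ∫ s in Ioo p q, f' s ^ 2 with hK
  have hK0 : 0 < K := by
    have : 0 ≤ ∫ s in Ioo p q, f' s ^ 2 := integral_nonneg fun s => sq_nonneg _
    linarith
  -- Since `F` vanishes at `q`, it is minus the integral of `f'` over `(x, q)`, which is small of
  -- order `√(q - x)`.
  have hFb : ∀ x ∈ Ioo p q, |F x| ≤ √(q - x) * K := by
    intro x hx
    have i1 := hf'.intervalIntegrable_Ioo hpq.le ⟨hx.1.le, hx.2.le⟩ (right_mem_Icc.2 hpq.le)
    have i2 := hf2.intervalIntegrable_Ioo hpq.le ⟨hx.1.le, hx.2.le⟩ (right_mem_Icc.2 hpq.le)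
    have i3 := hf'.intervalIntegrable_Ioo hpq.le (left_mem_Icc.2 hpq.le) ⟨hx.1.le, hx.2.le⟩
    have e : F x = -∫ s in x..q, f' s := by
      have := intervalIntegral.integral_add_adjacent_intervals i3 i1
      simp only [hF] at hFq ⊢
      linarith
    rw [e, abs_neg]
    refine (abs_integral_le_sqrt hx.2 i1 i2).trans ?_
    gcongr
    rw [hK, intervalIntegral.integral_of_le hx.2.le, integral_Ioc_eq_integral_Ioo]
    exact add_le_add_right (setIntegral_mono_set hf2 (ae_of_all _ fun s => sq_nonneg _)
      (Ioo_subset_Ioo_left hx.1.le).eventuallyLE) 1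
  have hibp : ∀ x ∈ Ioo p q, ∫ s in p..x, (f' s * u s + f s * g s) = F x * G x := by
    intro x hx
    have hsub : Ioo p x ⊆ Ioo p q := Ioo_subset_Ioo_right hx.2.le
    have i1 := hf'.intervalIntegrable_Ioo hpq.le (left_mem_Icc.2 hpq.le) ⟨hx.1.le, hx.2.le⟩
    have i2 := (hg x hx).intervalIntegrable_Ioo hx.1.le (left_mem_Icc.2 hx.1.le)
      (right_mem_Icc.2 hx.1.le)
    have e := integral_mul_add_mul_primitive (k := k) (l := 0) i1 i2
    simp only [zero_add, mul_zero, sub_zero] at e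
    rw [← e, intervalIntegral.integral_of_le hx.1.le, intervalIntegral.integral_of_le hx.1.le,
      integral_Ioc_eq_integral_Ioo, integral_Ioc_eq_integral_Ioo]
    refine integral_congr_ae ?_
    filter_upwards [ae_restrict_of_ae_restrict_of_subset hsub hrep,
      ae_restrict_of_ae_restrict_of_subset hsub hk] with s h1 h2
    rw [h1, h2]
  have hc := continuousOn_integral_Icc hpq.le hi q (right_mem_Icc.2 hpq.le)
  rw [ContinuousWithinAt, nhdsWithin_Icc_eq_nhdsLE hpq] at hc
  have hlim := hc.mono_left (nhdsWithin_mono _ Iio_subset_Iic_self)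
  rw [intervalIntegral.integral_of_le hpq.le, integral_Ioc_eq_integral_Ioo] at hlim
  -- The boundary term `F G` converges to `I` as `x` tends to `q`. If `I ≠ 0`, the smallness of `F`
  -- makes `u²` at least a multiple of `1 / (q - x)` near `q`, which is not integrable.
  by_contra hne
  set I := ∫ s in Ioo p q, (f' s * u s + f s * g s) with hI
  have hI0 : 0 < |I| := abs_pos.2 hne
  have hev : ∀ᶠ x in 𝓝[<] q, |I| / 2 < |∫ s in p..x, (f' s * u s + f s * g s)| :=
    hlim.abs.eventually (lt_mem_nhds (by linarith))
  obtain ⟨x₀, hx₀, hsub⟩ := mem_nhdsLT_iff_exists_Ioo_subset.1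
    (inter_mem hev (Ioo_mem_nhdsLT hpq))
  have hx₀ : x₀ < q := hx₀
  -- Squaring `|I| / 2 ≤ √(q - x) K |G x|` gives `δ ≤ (q - x) G²`.
  set δ := (|I| / (2 * K)) ^ 2 with hδ
  have hδ0 : 0 < δ := by positivity
  have hGb : ∀ x ∈ Ioo x₀ q, (q - x)⁻¹ ≤ δ⁻¹ * G x ^ 2 := by
    intro x hx
    obtain ⟨h1, h2⟩ := hsub hx
    have h1 : |I| / 2 < |∫ s in p..x, (f' s * u s + f s * g s)| := h1
    rw [hibp x h2, abs_mul] at h1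
    have hq : 0 < q - x := sub_pos.2 hx.2
    have h3 : |I| / 2 ≤ √(q - x) * K * |G x| :=
      h1.le.trans (mul_le_mul_of_nonneg_right (hFb x h2) (abs_nonneg _))
    have h4 : |I| / (2 * K) ≤ √(q - x) * |G x| := by
      rw [div_le_iff₀ (by positivity)]
      linarith
    have h5 : δ ≤ (q - x) * G x ^ 2 := by
      calc δ ≤ (√(q - x) * |G x|) ^ 2 := by
            rw [hδ]
            gcongr
        _ = (q - x) * G x ^ 2 := by rw [mul_pow, Real.sq_sqrt hq.le, sq_abs]
    rw [inv_mul_eq_div, inv_eq_one_div, div_le_div_iff₀ hq hδ0]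
    linarith
  have hsub2 : Ioo x₀ q ⊆ Ioo p q := fun x hx => (hsub hx).2
  have hint : IntegrableOn (fun x => (q - x)⁻¹) (Ioo x₀ q) := by
    refine Integrable.mono' ((hu.mono_set hsub2).const_mul δ⁻¹)
      (by fun_prop) ?_
    filter_upwards [ae_restrict_mem measurableSet_Ioo,
      ae_restrict_of_ae_restrict_of_subset hsub2 hrep] with x hx hx2
    rw [Real.norm_eq_abs, abs_of_pos (inv_pos.2 (sub_pos.2 hx.2)), hx2]
    exact hGb x hx
  have hint2 : IntervalIntegrable (fun x => (x - q)⁻¹) volume x₀ q := by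
    rw [intervalIntegrable_iff_integrableOn_Ioo_of_le hx₀.le]
    refine hint.neg.congr (ae_of_all _ fun x => ?_)
    simp only [Pi.neg_apply, ← inv_neg, neg_sub]
  rw [intervalIntegrable_sub_inv_iff] at hint2
  rcases hint2 with h1 | h1
  · exact hx₀.ne h1
  · exact h1 right_mem_uIcc

/-- Integration by parts for functions with integrable weak derivatives, one of which vanishes at
both end points. -/
theorem integral_by_parts_of_tendsto_zero_both {p q : ℝ} {u g f f' : ℝ → ℝ} (hpq : p < q)
    (h : HasWeakDerivOn (Ioo p q) u g) (h0 : EssTendstoRight u p 0) (h1 : EssTendstoLeft u q 0)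
    (hg : IntegrableOn g (Ioo p q)) (hf : HasWeakDerivOn (Ioo p q) f f')
    (hf' : IntegrableOn f' (Ioo p q)) :
    ∫ s in Ioo p q, (f' s * u s + f s * g s) = 0 := by
  have hrep := h.ae_eq_primitive_of_tendsto_zero h0
    fun x hx => hg.mono_set (Ioo_subset_Ioo_right hx.2.le)
  obtain ⟨k, hk⟩ := hf.ae_eq_primitive hpq hf'
  have hq : ∫ t in p..q, g t = 0 :=
    EssTendstoLeft.eq_of_continuousOn (u := fun x => ∫ t in p..x, g t) hpq
      (h1.congr_Ioo hpq hrep) (continuousOn_integral_Icc hpq.le hg)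
  have e := integral_mul_add_mul_primitive (k := k) (l := 0)
    (hf'.intervalIntegrable_Ioo hpq.le (left_mem_Icc.2 hpq.le) (right_mem_Icc.2 hpq.le))
    (hg.intervalIntegrable_Ioo hpq.le (left_mem_Icc.2 hpq.le) (right_mem_Icc.2 hpq.le))
  simp only [zero_add, mul_zero, sub_zero, hq] at e
  rw [← e, intervalIntegral.integral_of_le hpq.le, integral_Ioc_eq_integral_Ioo]
  refine integral_congr_ae ?_
  filter_upwards [hrep, hk] with s h1 h2
  rw [h1, h2]

/-! ## Reflection of an interval -/

theorem measurableEmbedding_sub_left (r : ℝ) : MeasurableEmbedding fun x : ℝ => r - x :=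
  (Homeomorph.subLeft r).measurableEmbedding

/-- The map `x ↦ p + q - x` exchanges the end points, so the results for a singularity at the right
end carry over to `(1, d)`, where the singularity is at the left. -/
theorem measurePreserving_reflect (p q : ℝ) :
    MeasurePreserving (fun x : ℝ => p + q - x) (volume.restrict (Ioo p q))
      (volume.restrict (Ioo p q)) := by
  have := (Measure.measurePreserving_sub_left (volume : Measure ℝ) (p + q)).restrict_preimage
    (measurableSet_Ioo (a := p) (b := q))
  rwa [preimage_const_sub_Ioo, add_sub_cancel_left, add_sub_cancel_right] at this

theorem integral_reflect {p q : ℝ} (f : ℝ → ℝ) :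
    ∫ x in Ioo p q, f (p + q - x) = ∫ x in Ioo p q, f x :=
  (measurePreserving_reflect p q).integral_comp (measurableEmbedding_sub_left _) f

theorem integrableOn_reflect {p q : ℝ} {f : ℝ → ℝ} (hf : IntegrableOn f (Ioo p q)) :
    IntegrableOn (fun x => f (p + q - x)) (Ioo p q) :=
  ((measurePreserving_reflect p q).integrable_comp_emb (measurableEmbedding_sub_left _)).2 hf

theorem locallyIntegrableOn_reflect {p q : ℝ} {f : ℝ → ℝ} (hf : LocallyIntegrableOn f (Ioo p q)) :
    LocallyIntegrableOn (fun x => f (p + q - x)) (Ioo p q) := by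
  rw [locallyIntegrableOn_iff isOpen_Ioo.isLocallyClosed] at hf ⊢
  intro K hK hc
  have hc' : IsCompact ((fun x => p + q - x) '' K) := hc.image (by fun_prop)
  have hK' : (fun x => p + q - x) '' K ⊆ Ioo p q := by
    rintro _ ⟨x, hx, rfl⟩
    have := hK hx
    exact ⟨by linarith [this.2], by linarith [this.1]⟩
  have h1 := ((Measure.measurePreserving_sub_left (volume : Measure ℝ) (p + q)).integrableOn_comp_preimage
    (measurableEmbedding_sub_left _)).2 (hf _ hK' hc')
  exact h1.mono_set (subset_preimage_image _ _)

theorem HasWeakDerivOn.reflect {p q : ℝ} {u g : ℝ → ℝ} (h : HasWeakDerivOn (Ioo p q) u g) :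
    HasWeakDerivOn (Ioo p q) (fun x => u (p + q - x)) (fun x => -g (p + q - x)) := by
  refine ⟨locallyIntegrableOn_reflect h.1, (locallyIntegrableOn_reflect h.2.1).neg,
    fun φ h1 h2 h3 => ?_⟩
  let ψ : ℝ → ℝ := fun x => φ (p + q - x)
  have hψ1 : ContDiff ℝ ∞ ψ := h1.comp (contDiff_const.sub contDiff_id)
  have hψ2 : HasCompactSupport ψ := h2.comp_homeomorph (Homeomorph.subLeft (p + q))
  have hψ3 : tsupport ψ ⊆ Ioo p q := by
    intro x hx
    have := h3 (tsupport_comp_subset_preimage φ (f := fun x => p + q - x) (by fun_prop) hx)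
    exact ⟨by linarith [this.2], by linarith [this.1]⟩
  have e := h.2.2 ψ hψ1 hψ2 hψ3
  rw [← integral_reflect, ← integral_reflect (fun x => g x * ψ x)] at e
  have hd : ∀ x, deriv ψ (p + q - x) = -deriv φ x := by
    intro x
    rw [deriv_comp_const_sub, sub_sub_cancel]
  simp only [hd, ψ, sub_sub_cancel, mul_neg, integral_neg, neg_mul] at e ⊢
  linarith

theorem tendsto_sub_left_ae (r : ℝ) :
    Tendsto (fun x : ℝ => r - x) (ae volume) (ae volume) :=
  (Measure.measurePreserving_sub_left (volume : Measure ℝ) r).quasiMeasurePreserving.tendsto_ae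

theorem EssTendstoLeft.reflect {p q l : ℝ} {u : ℝ → ℝ} (h : EssTendstoLeft u q l) :
    EssTendstoRight (fun x => u (p + q - x)) p l := by
  refine Tendsto.comp h (tendsto_inf.2 ⟨?_, ?_⟩)
  · refine Tendsto.mono_left (tendsto_nhdsWithin_iff.2 ⟨?_, ?_⟩) inf_le_left
    · have : Tendsto (fun x => p + q - x) (𝓝 p) (𝓝 (p + q - p)) := tendsto_id.const_sub _
      rw [add_sub_cancel_left] at this
      exact this.mono_left nhdsWithin_le_nhds
    · filter_upwards [self_mem_nhdsWithin] with x hx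
      have := mem_Ioi.1 hx
      exact mem_Iio.2 (by linarith)
  · exact (tendsto_sub_left_ae _).mono_left inf_le_right

theorem EssTendstoRight.reflect {p q l : ℝ} {u : ℝ → ℝ} (h : EssTendstoRight u p l) :
    EssTendstoLeft (fun x => u (p + q - x)) q l := by
  refine Tendsto.comp h (tendsto_inf.2 ⟨?_, ?_⟩)
  · refine Tendsto.mono_left (tendsto_nhdsWithin_iff.2 ⟨?_, ?_⟩) inf_le_left
    · have : Tendsto (fun x => p + q - x) (𝓝 q) (𝓝 (p + q - q)) := tendsto_id.const_sub _
      rw [add_sub_cancel_right] at this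
      exact this.mono_left nhdsWithin_le_nhds
    · filter_upwards [self_mem_nhdsWithin] with x hx
      have := mem_Iio.1 hx
      exact mem_Ioi.2 (by linarith)
  · exact (tendsto_sub_left_ae _).mono_left inf_le_right

theorem integral_sq_le_of_tendsto_zero_right {p q : ℝ} {u g : ℝ → ℝ} (hpq : p < q)
    (h : HasWeakDerivOn (Ioo p q) u g) (h0 : EssTendstoLeft u q 0)
    (hu : IntegrableOn (fun s => u s ^ 2) (Ioo p q))
    (hg : IntegrableOn (fun s => (s - p) ^ 2 * g s ^ 2) (Ioo p q)) :
    ∫ s in Ioo p q, u s ^ 2 ≤ 4 * ∫ s in Ioo p q, (s - p) ^ 2 * g s ^ 2 := by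
  have e : (fun s => (q - s) ^ 2 * (-g (p + q - s)) ^ 2) =
      fun s => (p + q - s - p) ^ 2 * g (p + q - s) ^ 2 := by
    ext s
    ring
  have := integral_sq_le_of_tendsto_zero hpq h.reflect h0.reflect (integrableOn_reflect hu)
    (by rw [e]; exact integrableOn_reflect hg)
  rw [e] at this
  rwa [integral_reflect (fun s => u s ^ 2),
    integral_reflect (fun s => (s - p) ^ 2 * g s ^ 2)] at this

theorem integral_by_parts_of_tendsto_zero_right {p q : ℝ} {u g f f' : ℝ → ℝ} (hpq : p < q)
    (h : HasWeakDerivOn (Ioo p q) u g) (h0 : EssTendstoLeft u q 0)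
    (hu : IntegrableOn (fun s => u s ^ 2) (Ioo p q))
    (hg : IntegrableOn (fun s => (s - p) ^ 2 * g s ^ 2) (Ioo p q))
    (hf : HasWeakDerivOn (Ioo p q) f f') (hf0 : EssTendstoRight f p 0)
    (hf' : IntegrableOn f' (Ioo p q)) (hf2 : IntegrableOn (fun s => f' s ^ 2) (Ioo p q))
    (hi : IntegrableOn (fun s => f' s * u s + f s * g s) (Ioo p q)) :
    ∫ s in Ioo p q, (f' s * u s + f s * g s) = 0 := by
  have e : (fun s => (q - s) ^ 2 * (-g (p + q - s)) ^ 2) =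
      fun s => (p + q - s - p) ^ 2 * g (p + q - s) ^ 2 := by
    ext s
    ring
  -- Both weak derivatives change sign under reflection, hence so does the whole integrand.
  have e2 : (fun s => -f' (p + q - s) * u (p + q - s) + f (p + q - s) * -g (p + q - s)) =
      fun s => -(f' (p + q - s) * u (p + q - s) + f (p + q - s) * g (p + q - s)) := by
    ext s
    ring
  have hg' : IntegrableOn (fun s => (q - s) ^ 2 * (-g (p + q - s)) ^ 2) (Ioo p q) := by
    rw [e]
    exact integrableOn_reflect hg
  have := integral_by_parts_of_tendsto_zero hpq h.reflect h0.reflect (integrableOn_reflect hu)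
    (fun x hx => integrableOn_of_sq_weight hx h.reflect.2.1 hg') hf.reflect hf0.reflect
    (integrableOn_reflect hf').neg (by simpa only [neg_sq] using integrableOn_reflect hf2)
    (by rw [e2]; exact (integrableOn_reflect hi).neg)
  rw [e2, integral_neg, neg_eq_zero,
    integral_reflect (fun s => f' s * u s + f s * g s)] at this
  exact this

/-! ## The weight near its zero -/

namespace DegenerateWeight

variable {c d : ℝ} (a : DegenerateWeight c d)

theorem continuousOn_sqrt : ContinuousOn (fun x => √(a x)) (Icc c d) :=
  a.continuousOn.sqrt

/-- An essential bound `K` on the reciprocal of `(√a)'`, which is almost everywhere nonzero, is a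
lower bound on `|(√a)'|`. Using `K + 1` avoids inverting zero. -/
theorem exists_deriv_sqrt_bound : ∃ m > 0, ∀ᵐ x ∂(volume.restrict (Ioo c d)),
    m ≤ |deriv (fun x => √(a x)) x| := by
  have hfin := a.inv_deriv_sqrt_memLp.2
  set K := eLpNorm (fun x => (deriv (fun x => √(a x)) x)⁻¹) ∞ (volume.restrict (Ioo c d)) with hK
  refine ⟨(K.toReal + 1)⁻¹, by positivity, ?_⟩
  rw [eLpNorm_exponent_top] at hK
  have hae := ae_le_eLpNormEssSup (f := fun x => (deriv (fun x => √(a x)) x)⁻¹)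
    (μ := volume.restrict (Ioo c d))
  filter_upwards [hae, a.deriv_sqrt_ne_zero] with x h1 h2
  rw [← hK] at h1
  have h3 := (ENNReal.toReal_le_toReal (by simp) hfin.ne).2 h1
  rw [toReal_enorm, Real.norm_eq_abs, abs_inv] at h3
  have h4 : 0 < |deriv (fun x => √(a x)) x| := abs_pos.2 h2
  rw [inv_le_comm₀ (by positivity) h4]
  linarith

theorem integral_deriv_sqrt {x y : ℝ} (h : uIcc x y ⊆ Icc c d \ {1}) :
    IntervalIntegrable (deriv fun x => √(a x)) volume x y ∧
      ∫ s in x..y, deriv (fun x => √(a x)) s = √(a y) - √(a x) := by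
  have h1 : ContDiffOn ℝ 1 (fun x => √(a x)) (uIcc x y) :=
    (a.contDiffOn.mono h).sqrt fun s hs => (a.pos s (h hs).1 (h hs).2).ne'
  have h2 := h1.absolutelyContinuousOnInterval
  exact ⟨h2.intervalIntegrable_deriv, h2.integral_deriv_eq_sub⟩

theorem exists_const_le_sqrt {K : Set ℝ} (hK : IsCompact K) (hs : K ⊆ Icc c d \ {1}) :
    ∃ m > 0, ∀ x ∈ K, m ≤ √(a x) := by
  rcases K.eq_empty_or_nonempty with rfl | hne
  · exact ⟨1, one_pos, by simp⟩
  obtain ⟨z, hz, hmin⟩ := hK.exists_isMinOn hne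
    (a.continuousOn_sqrt.mono (hs.trans sdiff_subset))
  exact ⟨√(a z), Real.sqrt_pos.2 (a.pos z (hs hz).1 (hs hz).2), fun x hx => hmin hx⟩

/-- Near `1`, monotonicity of `a` fixes the sign of `(√a)'`, so the lower bound on its modulus can
be integrated. Away from `1`, `√a` is bounded below by compactness. -/
theorem exists_le_left : ∃ m > 0, ∀ x ∈ Icc c 1, m * (1 - x) ≤ √(a x) := by
  obtain ⟨x₁, hx₁, hanti, -⟩ := a.left
  obtain ⟨m, hm, hbd⟩ := a.exists_deriv_sqrt_bound
  obtain ⟨m', hm', hbd'⟩ := a.exists_const_le_sqrt (isCompact_Icc (a := c) (b := x₁))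
    fun x hx => ⟨⟨hx.1, (hx.2.trans_lt hx₁.2).le.trans a.one_lt_d.le⟩, (hx.2.trans_lt hx₁.2).ne⟩
  have hd : ∀ x ∈ Ioo x₁ 1, deriv (fun x => √(a x)) x ≤ 0 := by
    intro x hx
    have h1 : AntitoneOn (fun x => √(a x)) (Ioo x₁ 1) := fun s hs t ht hst =>
      Real.sqrt_le_sqrt (hanti hs ht hst)
    rw [← derivWithin_of_isOpen isOpen_Ioo hx]
    exact h1.derivWithin_nonpos
  -- Integrating `(√a)' ≤ -m` only up to `y < 1` stays where `√a` is continuously differentiable;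
  -- the term `√(a y) ≥ 0` is dropped before `y` tends to `1`.
  have key : ∀ x ∈ Ioo x₁ 1, ∀ y ∈ Ioo x₁ 1, x < y → m * (y - x) ≤ √(a x) := by
    intro x hx y hy hxy
    have hsub : uIcc x y ⊆ Icc c d \ {1} := by
      rw [uIcc_of_le hxy.le]
      exact fun s hs => ⟨⟨hx₁.1.trans (hx.1.le.trans hs.1),
        hs.2.trans (hy.2.le.trans a.one_lt_d.le)⟩, (hs.2.trans_lt hy.2).ne⟩
    obtain ⟨hi, he⟩ := a.integral_deriv_sqrt hsub
    have : ∫ s in x..y, deriv (fun x => √(a x)) s ≤ ∫ s in x..y, -m := by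
      refine intervalIntegral.integral_mono_ae_restrict hxy.le hi intervalIntegrable_const ?_
      rw [← restrict_Ioo_eq_restrict_Icc]
      have hsub' : Ioo x y ⊆ Ioo c d := fun s hs => ⟨hx₁.1.trans_lt (hx.1.trans hs.1),
        hs.2.trans (hy.2.trans a.one_lt_d)⟩
      filter_upwards [ae_restrict_of_ae_restrict_of_subset hsub' hbd,
        ae_restrict_mem measurableSet_Ioo] with s h1 h2
      rw [abs_of_nonpos (hd s ⟨hx.1.trans h2.1, h2.2.trans hy.2⟩)] at h1
      linarith
    rw [he, intervalIntegral.integral_const, smul_eq_mul] at this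
    linarith [Real.sqrt_nonneg (a y)]
  have key2 : ∀ x ∈ Ioo x₁ 1, m * (1 - x) ≤ √(a x) := by
    intro x hx
    have hl : Tendsto (fun y => m * (y - x)) (𝓝[<] 1) (𝓝 (m * (1 - x))) :=
      ((tendsto_id.sub_const x).const_mul m).mono_left nhdsWithin_le_nhds
    refine le_of_tendsto hl ?_
    filter_upwards [Ioo_mem_nhdsLT hx.2] with y hy
    exact key x hx y ⟨hx.1.trans hy.1, hy.2⟩ hy.1
  refine ⟨min m m', lt_min hm hm', fun x hx => ?_⟩
  rcases eq_or_lt_of_le hx.2 with rfl | hlt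
  · simp
  rcases le_or_gt x x₁ with hle | hgt
  -- Here `c ≥ 0` enters, bounding the distance to `1` by one.
  · have h2 : 1 - x ≤ 1 := by linarith [hx.1, a.c_nonneg]
    calc min m m' * (1 - x) ≤ m' * 1 :=
          mul_le_mul (min_le_right _ _) h2 (by linarith) hm'.le
      _ ≤ √(a x) := by simpa using hbd' x ⟨hx.1, hle⟩
  · exact (mul_le_mul_of_nonneg_right (min_le_left _ _) (by linarith)).trans (key2 x ⟨hgt, hlt⟩)

theorem exists_le_right : ∃ m > 0, ∀ x ∈ Icc 1 d, m * (x - 1) ≤ √(a x) := by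
  obtain ⟨x₂, hx₂, hmono, -⟩ := a.right
  obtain ⟨m, hm, hbd⟩ := a.exists_deriv_sqrt_bound
  obtain ⟨m', hm', hbd'⟩ := a.exists_const_le_sqrt (isCompact_Icc (a := x₂) (b := d))
    fun x hx => ⟨⟨a.c_lt_one.le.trans (hx₂.1.le.trans hx.1), hx.2⟩, (hx₂.1.trans_le hx.1).ne'⟩
  have hd : ∀ x ∈ Ioo 1 x₂, 0 ≤ deriv (fun x => √(a x)) x := by
    intro x hx
    have h1 : MonotoneOn (fun x => √(a x)) (Ioo 1 x₂) := fun s hs t ht hst =>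
      Real.sqrt_le_sqrt (hmono hs ht hst)
    rw [← derivWithin_of_isOpen isOpen_Ioo hx]
    exact h1.derivWithin_nonneg
  have key : ∀ x ∈ Ioo 1 x₂, ∀ y ∈ Ioo 1 x₂, y < x → m * (x - y) ≤ √(a x) := by
    intro x hx y hy hxy
    have hsub : uIcc y x ⊆ Icc c d \ {1} := by
      rw [uIcc_of_le hxy.le]
      exact fun s hs => ⟨⟨a.c_lt_one.le.trans (hy.1.le.trans hs.1),
        hs.2.trans (hx.2.le.trans hx₂.2)⟩, (hy.1.trans_le hs.1).ne'⟩
    obtain ⟨hi, he⟩ := a.integral_deriv_sqrt hsub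
    have : ∫ s in y..x, m ≤ ∫ s in y..x, deriv (fun x => √(a x)) s := by
      refine intervalIntegral.integral_mono_ae_restrict hxy.le intervalIntegrable_const hi ?_
      rw [← restrict_Ioo_eq_restrict_Icc]
      have hsub' : Ioo y x ⊆ Ioo c d := fun s hs => ⟨a.c_lt_one.trans (hy.1.trans hs.1),
        hs.2.trans_le (hx.2.le.trans hx₂.2)⟩
      filter_upwards [ae_restrict_of_ae_restrict_of_subset hsub' hbd,
        ae_restrict_mem measurableSet_Ioo] with s h1 h2
      rwa [abs_of_nonneg (hd s ⟨hy.1.trans h2.1, h2.2.trans hx.2⟩)] at h1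
    rw [he, intervalIntegral.integral_const, smul_eq_mul] at this
    linarith [Real.sqrt_nonneg (a y)]
  have key2 : ∀ x ∈ Ioo 1 x₂, m * (x - 1) ≤ √(a x) := by
    intro x hx
    have hl : Tendsto (fun y => m * (x - y)) (𝓝[>] 1) (𝓝 (m * (x - 1))) :=
      ((tendsto_id.const_sub x).const_mul m).mono_left nhdsWithin_le_nhds
    refine le_of_tendsto hl ?_
    filter_upwards [Ioo_mem_nhdsGT hx.1] with y hy
    exact key x hx y ⟨hy.1, hy.2.trans hx.2⟩ hy.2
  refine ⟨min m m', lt_min hm hm', fun x hx => ?_⟩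
  rcases eq_or_lt_of_le hx.1 with rfl | hlt
  · simp
  rcases lt_or_ge x x₂ with hgt | hle
  · exact (mul_le_mul_of_nonneg_right (min_le_left _ _) (by linarith)).trans (key2 x ⟨hlt, hgt⟩)
  · have h2 : x - 1 ≤ 1 := by linarith [hx.2, a.d_le_two]
    calc min m m' * (x - 1) ≤ m' * 1 :=
          mul_le_mul (min_le_right _ _) h2 (by linarith) hm'.le
      _ ≤ √(a x) := by simpa using hbd' x ⟨hle, hx.2⟩

/-- This compares the degenerate weight with the weight `(x - 1)²` of Hardy's inequality. -/
theorem exists_sq_le : ∃ C, 0 ≤ C ∧ ∀ x ∈ Icc c d, (x - 1) ^ 2 ≤ C * a x := by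
  obtain ⟨m₁, hm₁, h₁⟩ := a.exists_le_left
  obtain ⟨m₂, hm₂, h₂⟩ := a.exists_le_right
  have h0 : ∀ x ∈ Icc c d, 0 ≤ a x := fun x hx => by
    rcases eq_or_ne x 1 with rfl | h
    · exact a.map_one.ge
    · exact (a.pos x hx h).le
  refine ⟨(m₁ ^ 2)⁻¹ + (m₂ ^ 2)⁻¹, by positivity, fun x hx => ?_⟩
  have key : ∀ {m y : ℝ}, 0 < m → 0 ≤ y → m * y ≤ √(a x) → y ^ 2 ≤ (m ^ 2)⁻¹ * a x := by
    intro m y hm hy h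
    rw [inv_mul_eq_div, le_div_iff₀ (by positivity), ← Real.sq_sqrt (h0 x hx)]
    calc y ^ 2 * m ^ 2 = (m * y) ^ 2 := by ring
      _ ≤ _ := by gcongr
  have p₁ : 0 ≤ (m₁ ^ 2)⁻¹ * a x := mul_nonneg (by positivity) (h0 x hx)
  have p₂ : 0 ≤ (m₂ ^ 2)⁻¹ * a x := mul_nonneg (by positivity) (h0 x hx)
  rw [add_mul]
  rcases le_total x 1 with h | h
  · have := key hm₁ (sub_nonneg.2 h) (h₁ x ⟨hx.1, h⟩)
    nlinarith
  · have := key hm₂ (sub_nonneg.2 h) (h₂ x ⟨h, hx.2⟩)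
    linarith

end DegenerateWeight

/-! ## Poincaré's inequality -/

theorem setIntegral_Ioo_split {c m d : ℝ} (hcm : c < m) (hmd : m < d) {f : ℝ → ℝ}
    (hf : IntegrableOn f (Ioo c d)) :
    ∫ x in Ioo c d, f x = (∫ x in Ioo c m, f x) + ∫ x in Ioo m d, f x := by
  have hcd := hcm.trans hmd
  have h1 := hf.intervalIntegrable_Ioo hcd.le (left_mem_Icc.2 hcd.le) ⟨hcm.le, hmd.le⟩
  have h2 := hf.intervalIntegrable_Ioo hcd.le ⟨hcm.le, hmd.le⟩ (right_mem_Icc.2 hcd.le)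
  have := intervalIntegral.integral_add_adjacent_intervals h1 h2
  rw [intervalIntegral.integral_of_le hcm.le, intervalIntegral.integral_of_le hmd.le,
    intervalIntegral.integral_of_le hcd.le, integral_Ioc_eq_integral_Ioo,
    integral_Ioc_eq_integral_Ioo, integral_Ioc_eq_integral_Ioo] at this
  exact this.symm

section Weighted

variable {c d : ℝ} {a : DegenerateWeight c d}

theorem L2.integrable_sq (u : L2 c d) : IntegrableOn (fun x => u x ^ 2) (Ioo c d) :=
  (Lp.memLp u).integrable_sq

theorem L2.norm_sq (u : L2 c d) : ‖u‖ ^ 2 = ∫ x in Ioo c d, u x ^ 2 := by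
  rw [← real_inner_self_eq_norm_sq, L2.inner_def]
  refine integral_congr_ae (ae_of_all _ fun x => ?_)
  simp [sq]

theorem DegenerateWeight.Ioo_left_subset (a : DegenerateWeight c d) :
    Ioo c 1 ⊆ Ioo c d \ {1} := fun _ hx =>
  ⟨⟨hx.1, hx.2.trans a.one_lt_d⟩, hx.2.ne⟩

theorem DegenerateWeight.Ioo_right_subset (a : DegenerateWeight c d) :
    Ioo 1 d ⊆ Ioo c d \ {1} := fun _ hx =>
  ⟨⟨a.c_lt_one.trans hx.1, hx.2⟩, hx.1.ne'⟩

theorem integrableOn_sq_mul_spaceDeriv_sq {u : L2 c d} (hu : FiniteNorm a u) :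
    IntegrableOn (fun x => (x - 1) ^ 2 * spaceDeriv u x ^ 2) (Ioo c d) := by
  obtain ⟨C, -, hC⟩ := a.exists_sq_le
  obtain ⟨h1, h2⟩ := spaceDeriv_spec hu
  have hm := h1.2.1.aestronglyMeasurable
  rw [restrict_punctured] at hm
  refine Integrable.mono' (h2.const_mul C)
    (((continuous_id.sub continuous_const).pow 2).aestronglyMeasurable.mul (hm.pow 2)) ?_
  filter_upwards [ae_restrict_mem measurableSet_Ioo] with x hx
  rw [Real.norm_eq_abs, abs_of_nonneg (by positivity), ← mul_assoc]
  exact mul_le_mul_of_nonneg_right (hC x (Ioo_subset_Icc_self hx)) (sq_nonneg _)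

/-- Hardy's inequality is applied on `(c, 1)` and on `(1, d)`, each time from the outer end point
where `u` vanishes. No information at `1` is needed. -/
theorem exists_poincare (a : DegenerateWeight c d) : ∃ C, 0 ≤ C ∧ ∀ u ∈ W10 a,
    ‖u‖ ^ 2 ≤ C * ∫ x in Ioo c d, a x * spaceDeriv u x ^ 2 := by
  obtain ⟨C, hC0, hC⟩ := a.exists_sq_le
  refine ⟨4 * C, by positivity, fun u hu => ?_⟩
  have hf := finiteNorm_of_mem_W10 hu
  obtain ⟨h1, h2⟩ := spaceDeriv_spec hf
  have hw := integrableOn_sq_mul_spaceDeriv_sq hf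
  have hl : Ioo c 1 ⊆ Ioo c d := a.Ioo_left_subset.trans sdiff_subset
  have hr : Ioo 1 d ⊆ Ioo c d := a.Ioo_right_subset.trans sdiff_subset
  have e : ∀ x : ℝ, (1 - x) ^ 2 = (x - 1) ^ 2 := fun x => by ring
  have k1 := integral_sq_le_of_tendsto_zero a.c_lt_one (h1.mono a.Ioo_left_subset) hu.2.1
    ((L2.integrable_sq u).mono_set hl) (by simpa only [e] using hw.mono_set hl)
  have k2 := integral_sq_le_of_tendsto_zero_right a.one_lt_d (h1.mono a.Ioo_right_subset) hu.2.2
    ((L2.integrable_sq u).mono_set hr) (hw.mono_set hr)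
  simp only [e] at k1
  have k3 := setIntegral_Ioo_split a.c_lt_one a.one_lt_d hw
  have k4 : ∫ x in Ioo c d, (x - 1) ^ 2 * spaceDeriv u x ^ 2 ≤
      C * ∫ x in Ioo c d, a x * spaceDeriv u x ^ 2 := by
    rw [← integral_const_mul]
    refine setIntegral_mono_on hw (h2.const_mul C) measurableSet_Ioo fun x hx => ?_
    rw [← mul_assoc]
    exact mul_le_mul_of_nonneg_right (hC x (Ioo_subset_Icc_self hx)) (sq_nonneg _)
  rw [L2.norm_sq, setIntegral_Ioo_split a.c_lt_one a.one_lt_d (L2.integrable_sq u)]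
  linarith

/-! ## Completeness of the energy space -/

theorem memLp_sqrt_mul_spaceDeriv {u : L2 c d} (hu : FiniteNorm a u) :
    MemLp (fun x => √(a x) * spaceDeriv u x) 2 (volume.restrict (Ioo c d)) := by
  obtain ⟨h1, h2⟩ := spaceDeriv_spec hu
  have hm := h1.2.1.aestronglyMeasurable
  rw [restrict_punctured] at hm
  have hs : AEStronglyMeasurable (fun x => √(a x)) (volume.restrict (Ioo c d)) :=
    (a.continuousOn_sqrt.mono Ioo_subset_Icc_self).aestronglyMeasurable measurableSet_Ioo
  refine (memLp_two_iff_integrable_sq (hs.mul hm)).2 (h2.congr ?_)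
  filter_upwards [ae_restrict_mem measurableSet_Ioo] with x hx
  rw [Pi.mul_apply, mul_pow, Real.sq_sqrt (a.nonneg hx)]

namespace EnergySpace

variable {V : IntermediateSpace a}

/-- The linear isometry `u ↦ √a u_x` into `L²(c, d)`. -/
noncomputable def weightedDeriv (V : IntermediateSpace a) : EnergySpace V →ₗᵢ[ℝ] L2 c d where
  toFun u := (memLp_sqrt_mul_spaceDeriv u.finiteNorm).toLp _
  map_add' u w := by
    rw [← MemLp.toLp_add]
    refine MemLp.toLp_congr _ _ ?_
    filter_upwards [spaceDeriv_add u.finiteNorm w.finiteNorm] with x hx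
    change _ * spaceDeriv (u.toL2 + w.toL2) x = _
    rw [hx, Pi.add_apply, mul_add]
  map_smul' r u := by
    rw [RingHom.id_apply, ← MemLp.toLp_const_smul]
    refine MemLp.toLp_congr _ _ ?_
    filter_upwards [spaceDeriv_smul u.finiteNorm r] with x hx
    change _ * spaceDeriv (r • u.toL2) x = _
    rw [hx, Pi.smul_apply, smul_eq_mul]
    ring
  norm_map' u := by
    refine (sq_eq_sq₀ (norm_nonneg _) (norm_nonneg _)).1 ?_
    rw [L2.norm_sq, ← real_inner_self_eq_norm_sq, inner_def]
    refine integral_congr_ae ?_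
    filter_upwards [(memLp_sqrt_mul_spaceDeriv u.finiteNorm).coeFn_toLp,
      ae_restrict_mem measurableSet_Ioo] with x hx hx2
    change (MemLp.toLp _ (memLp_sqrt_mul_spaceDeriv u.finiteNorm) : L2 c d) x ^ 2 = _
    rw [hx, mul_pow, Real.sq_sqrt (a.nonneg hx2)]
    ring

theorem weightedDeriv_ae (u : EnergySpace V) : weightedDeriv V u =ᵐ[volume.restrict (Ioo c d)]
    fun x => √(a x) * spaceDeriv u.toL2 x :=
  (memLp_sqrt_mul_spaceDeriv u.finiteNorm).coeFn_toLp

theorem norm_sq_eq (u : EnergySpace V) :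
    ‖u‖ ^ 2 = ∫ x in Ioo c d, a x * spaceDeriv u.toL2 x ^ 2 := by
  rw [← real_inner_self_eq_norm_sq, inner_def]
  simp only [sq]

/-- The continuous embedding of `V` into `L²(c, d)`. -/
noncomputable def embedding (V : IntermediateSpace a) : EnergySpace V →L[ℝ] L2 c d :=
  LinearMap.mkContinuousOfExistsBound
    { toFun := toL2
      map_add' := fun _ _ => rfl
      map_smul' := fun _ _ => rfl } (by
    obtain ⟨C, hC0, hC⟩ := exists_poincare a
    refine ⟨√C, fun u => ?_⟩
    refine (sq_le_sq₀ (norm_nonneg _) (by positivity)).1 ?_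
    rw [mul_pow, Real.sq_sqrt hC0, norm_sq_eq]
    exact hC _ u.mem_W10)

end EnergySpace

theorem tendsto_integral_mul_of_memLp {ι : Type*} {l : Filter ι} {f : ι → L2 c d} {f₀ : L2 c d}
    (hf : Tendsto f l (𝓝 f₀)) {ψ : ℝ → ℝ} (hψ : MemLp ψ 2 (volume.restrict (Ioo c d))) :
    Tendsto (fun i => ∫ x in Ioo c d, f i x * ψ x) l (𝓝 (∫ x in Ioo c d, f₀ x * ψ x)) := by
  have key : ∀ f : L2 c d, ∫ x in Ioo c d, f x * ψ x = inner ℝ (hψ.toLp ψ) f := by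
    intro f
    rw [L2.inner_def]
    refine integral_congr_ae ?_
    filter_upwards [hψ.coeFn_toLp] with x hx
    simp [hx]
  simp only [key]
  exact tendsto_const_nhds.inner hf

/-- Weak derivatives pass to the limit if `uₙ → u` and `√a uₙ' → γ` in `L²`. -/
theorem hasWeakDerivOn_of_tendsto {U : Set ℝ}
    (hU : (volume.restrict U : Measure ℝ) = volume.restrict (Ioo c d))
    {u : ℕ → L2 c d} {u₀ : L2 c d} {γ : ℕ → L2 c d} {γ₀ : L2 c d} {g : ℕ → ℝ → ℝ}
    (hu : Tendsto u atTop (𝓝 u₀)) (hγ : Tendsto γ atTop (𝓝 γ₀))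
    (h : ∀ n, HasWeakDerivOn U (u n) (g n))
    (hg : ∀ n, γ n =ᵐ[volume.restrict (Ioo c d)] fun x => √(a x) * g n x)
    (hloc₀ : LocallyIntegrableOn u₀ U) (hloc : LocallyIntegrableOn (fun x => γ₀ x * (√(a x))⁻¹) U)
    (htest : ∀ φ : ℝ → ℝ, Continuous φ → HasCompactSupport φ → tsupport φ ⊆ U →
      MemLp (fun x => (√(a x))⁻¹ * φ x) 2 (volume.restrict (Ioo c d))) :
    HasWeakDerivOn U u₀ (fun x => γ₀ x * (√(a x))⁻¹) := by
  refine ⟨hloc₀, hloc, fun φ h1 h2 h3 => ?_⟩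
  have hd : Continuous (deriv φ) := h1.continuous_deriv (by simp)
  have l1 := tendsto_integral_mul_of_memLp hu
    ((hd.memLp_of_hasCompactSupport h2.deriv (p := 2) (μ := volume)).restrict (Ioo c d))
  -- The integral of `uₙ' φ` is the `L²` pairing of `√a uₙ'` with the fixed function `φ / √a`.
  have l2 := (tendsto_integral_mul_of_memLp hγ (htest φ h1.continuous h2 h3)).neg
  rw [hU]
  simp only [mul_assoc]
  refine tendsto_nhds_unique l1 (l2.congr fun n => ?_)
  have e := (h n).2.2 φ h1 h2 h3
  rw [hU] at e
  rw [e]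
  congr 1
  refine integral_congr_ae ?_
  have hne : ∀ᵐ x ∂(volume.restrict (Ioo c d) : Measure ℝ), x ≠ 1 :=
    ae_restrict_of_ae (by simp [ae_iff])
  filter_upwards [hg n, hne, ae_restrict_mem measurableSet_Ioo] with x hx hx1 hx2
  have hp : √(a x) ≠ 0 := (Real.sqrt_pos.2 (a.pos x (Ioo_subset_Icc_self hx2) hx1)).ne'
  rw [hx]
  field_simp

theorem DegenerateWeight.continuousOn_inv_sqrt (a : DegenerateWeight c d) :
    ContinuousOn (fun x => (√(a x))⁻¹) (Ioo c d \ {1}) :=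
  (a.continuousOn_sqrt.mono (sdiff_subset.trans Ioo_subset_Icc_self)).inv₀ fun x hx =>
    (Real.sqrt_pos.2 (a.pos x (Ioo_subset_Icc_self hx.1) hx.2)).ne'

theorem DegenerateWeight.aestronglyMeasurable_inv_sqrt (a : DegenerateWeight c d) :
    AEStronglyMeasurable (fun x => (√(a x))⁻¹) (volume.restrict (Ioo c d)) := by
  rw [← restrict_punctured]
  exact a.continuousOn_inv_sqrt.aestronglyMeasurable (isOpen_punctured c d).measurableSet

theorem DegenerateWeight.IsWeak.memLp (hw : a.IsWeak) :
    MemLp (fun x => (√(a x))⁻¹) 2 (volume.restrict (Ioo c d)) := by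
  refine (memLp_two_iff_integrable_sq a.aestronglyMeasurable_inv_sqrt).2 (Integrable.congr hw ?_)
  filter_upwards [ae_restrict_mem measurableSet_Ioo] with x hx
  rw [inv_pow, Real.sq_sqrt (a.nonneg hx), one_div]

/-- The support of `φ` is a compact set that avoids `1`, and `1 / √a` is bounded on it. -/
theorem memLp_inv_sqrt_mul_test (a : DegenerateWeight c d) {φ : ℝ → ℝ} (hφ : Continuous φ)
    (hc : HasCompactSupport φ) (hs : tsupport φ ⊆ Ioo c d \ {1}) :
    MemLp (fun x => (√(a x))⁻¹ * φ x) 2 (volume.restrict (Ioo c d)) := by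
  obtain ⟨M, hM⟩ := hc.isCompact.exists_bound_of_continuousOn
    ((a.continuousOn_inv_sqrt.mono hs).mul hφ.continuousOn)
  refine MemLp.of_bound (a.aestronglyMeasurable_inv_sqrt.mul hφ.aestronglyMeasurable) |M|
    (ae_of_all _ fun x => ?_)
  by_cases hx : x ∈ tsupport φ
  · exact (hM x hx).trans (le_abs_self M)
  · simp [image_eq_zero_of_notMem_tsupport hx]

theorem L2.locallyIntegrableOn (u : L2 c d) {U : Set ℝ} (hU : U ⊆ Ioo c d) :
    LocallyIntegrableOn u U := by
  have : IntegrableOn u (Ioo c d) := (Lp.memLp u).integrable (by norm_num)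
  exact (this.mono_set hU).locallyIntegrableOn

theorem L2.locallyIntegrableOn_mul_inv_sqrt (a : DegenerateWeight c d) (γ : L2 c d) :
    LocallyIntegrableOn (fun x => γ x * (√(a x))⁻¹) (Ioo c d \ {1}) := by
  rw [locallyIntegrableOn_iff (isOpen_punctured c d).isLocallyClosed]
  intro K hK hc
  have h1 : IntegrableOn γ K :=
    (L2.locallyIntegrableOn γ (sdiff_subset (t := {1}))).integrableOn_compact_subset hK hc
  exact h1.mul_continuousOn (a.continuousOn_inv_sqrt.mono hK) hc

/-- Closedness of `u ↦ √a u_x`: the limit `u₀` has weak derivative `γ / √a`, so it lies in `W¹_a`,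
and the closedness of `V` in `‖·‖_a` puts it in `V`. -/
theorem exists_weightedDeriv_eq (V : IntermediateSpace a) {u : ℕ → EnergySpace V} {u₀ γ : L2 c d}
    (hu : Tendsto (fun n => (u n).toL2) atTop (𝓝 u₀))
    (hγ : Tendsto (fun n => EnergySpace.weightedDeriv V (u n)) atTop (𝓝 γ)) :
    ∃ w : EnergySpace V, EnergySpace.weightedDeriv V w = γ := by
  have hne : ∀ᵐ x ∂(volume.restrict (Ioo c d) : Measure ℝ), x ≠ 1 :=
    ae_restrict_of_ae (by simp [ae_iff])
  have hG : ∀ᵐ x ∂(volume.restrict (Ioo c d) : Measure ℝ), √(a x) * (γ x * (√(a x))⁻¹) = γ x := by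
    filter_upwards [hne, ae_restrict_mem measurableSet_Ioo] with x hx1 hx2
    have hp : √(a x) ≠ 0 := (Real.sqrt_pos.2 (a.pos x (Ioo_subset_Icc_self hx2) hx1)).ne'
    field_simp
  have hD : HasWeakDerivOn (Ioo c d \ {1}) u₀ (fun x => γ x * (√(a x))⁻¹) :=
    hasWeakDerivOn_of_tendsto (restrict_punctured c d) hu hγ
      (fun n => (spaceDeriv_spec (u n).finiteNorm).1) (fun n => (u n).weightedDeriv_ae)
      (L2.locallyIntegrableOn u₀ sdiff_subset) (L2.locallyIntegrableOn_mul_inv_sqrt a γ)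
      fun φ => memLp_inv_sqrt_mul_test a
  have hE : IntegrableOn (fun x => a x * (γ x * (√(a x))⁻¹) ^ 2) (Ioo c d) := by
    refine (L2.integrable_sq γ).congr ?_
    filter_upwards [hG, ae_restrict_mem measurableSet_Ioo] with x hx hx2
    rw [← hx, mul_pow, Real.sq_sqrt (a.nonneg hx2), hx]
  -- For a weak degeneration `1 / √a ∈ L²`. Hence `γ / √a ∈ L¹`, and test functions whose support
  -- contains `1` are admissible in the limit as well.
  have hW : u₀ ∈ W1 a := by
    refine ⟨_, hD, hE, fun hw => ?_⟩
    have hi : IntegrableOn (fun x => γ x * (√(a x))⁻¹) (Ioo c d) :=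
      (Lp.memLp γ).integrable_mul hw.memLp
    refine ⟨?_, hi⟩
    refine hasWeakDerivOn_of_tendsto rfl hu hγ (g := fun n => spaceDeriv (u n).toL2)
      (fun n => ?_) (fun n => (u n).weightedDeriv_ae)
      (L2.locallyIntegrableOn u₀ subset_rfl) hi.locallyIntegrableOn fun φ hφ hc _ => ?_
    · obtain ⟨g, hg, -, hwk⟩ := (u n).mem_W10.1
      have := weakDeriv_ae (isOpen_punctured c d) hg
      rw [restrict_punctured] at this
      exact (hwk hw).1.congr (ae_eq_refl _) this.symm
    · obtain ⟨M, hM⟩ := hc.exists_bound_of_continuous hφ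
      refine MemLp.of_le_mul (c := M) hw.memLp
        (a.aestronglyMeasurable_inv_sqrt.mul hφ.aestronglyMeasurable) (ae_of_all _ fun x => ?_)
      rw [norm_mul, mul_comm]
      exact mul_le_mul_of_nonneg_right (hM x) (norm_nonneg _)
  have hsd : (fun x => √(a x) * spaceDeriv u₀ x) =ᵐ[volume.restrict (Ioo c d)] γ := by
    have := weakDeriv_ae (isOpen_punctured c d) hD
    rw [restrict_punctured] at this
    filter_upwards [this, hG] with x hx hx2
    rw [spaceDeriv, hx, hx2]
  have hdist : ∀ n, distSq a u₀ (u n).toL2 (spaceDeriv (u n).toL2) =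
      ‖u₀ - (u n).toL2‖ ^ 2 + ‖γ - EnergySpace.weightedDeriv V (u n)‖ ^ 2 := by
    intro n
    rw [L2.norm_sq, L2.norm_sq, ← integral_add (L2.integrable_sq _) (L2.integrable_sq _), distSq]
    refine integral_congr_ae ?_
    filter_upwards [Lp.coeFn_sub u₀ (u n).toL2, Lp.coeFn_sub γ (EnergySpace.weightedDeriv V (u n)),
      (u n).weightedDeriv_ae, hsd, ae_restrict_mem measurableSet_Ioo] with x h1 h2 h3 h4 h5
    rw [h1, h2, Pi.sub_apply, Pi.sub_apply, h3, ← h4, ← mul_sub, mul_pow,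
      Real.sq_sqrt (a.nonneg h5)]
  have hmem : u₀ ∈ V.carrier := by
    refine V.closed u₀ hW fun ε hε => ?_
    have l1 := ((tendsto_const_nhds (x := u₀)).sub hu).norm.pow 2
    have l2 := ((tendsto_const_nhds (x := γ)).sub hγ).norm.pow 2
    have l3 := l1.add l2
    simp only [sub_self, norm_zero, ne_eq, OfNat.ofNat_ne_zero, not_false_eq_true, zero_pow,
      add_zero] at l3
    obtain ⟨n, hn⟩ := (l3.eventually (gt_mem_nhds hε)).exists
    exact ⟨(u n).toL2, (u n).toSub.2, by rwa [hdist]⟩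
  refine ⟨⟨⟨u₀, hmem⟩⟩, Lp.ext ?_⟩
  exact (EnergySpace.weightedDeriv_ae _).trans hsd

/-- A Cauchy sequence in `V` is Cauchy in `L²` by Poincaré, and so are its weighted derivatives;
since `u ↦ √a u_x` is isometric, convergence of the latter to a value of the map is convergence in
`V`. -/
instance EnergySpace.completeSpace (V : IntermediateSpace a) : CompleteSpace (EnergySpace V) := by
  refine Metric.complete_of_cauchySeq_tendsto fun u hu => ?_
  obtain ⟨u₀, hu₀⟩ := cauchySeq_tendsto_of_complete
    ((EnergySpace.embedding V).uniformContinuous.comp_cauchySeq hu)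
  obtain ⟨γ, hγ⟩ := cauchySeq_tendsto_of_complete
    ((EnergySpace.weightedDeriv V).isometry.uniformContinuous.comp_cauchySeq hu)
  obtain ⟨w, rfl⟩ := exists_weightedDeriv_eq V hu₀ hγ
  exact ⟨w, (EnergySpace.weightedDeriv V).isometry.isEmbedding.tendsto_nhds_iff.2 hγ⟩

/-! ## Skew-symmetry of the wave operator -/

/-- The scalar product is the integral of the derivative of flux times `v`, so only boundary terms
could survive. -/
theorem WaveOperator.inner_eq_zero {V : IntermediateSpace a} {U F : StateSpace V}
    (h : WaveOperator V U F) : inner ℝ U F = 0 := by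
  obtain ⟨hdom, hfst, hsnd⟩ := h
  set f := flux a U.fst.toL2 with hf
  have hv : U.snd ∈ W10 a := V.subset_W10 hdom.snd_mem
  have hvf := finiteNorm_of_mem_W10 hv
  obtain ⟨hfL, f', hf'L, hff'⟩ := hdom.fst_mem.2
  have hwd := weakDeriv_ae isOpen_Ioo hff'
  have hf'i : IntegrableOn f' (Ioo c d) := hf'L.integrable (by norm_num)
  have i1 : IntegrableOn (fun x => f' x * U.snd x) (Ioo c d) := hf'L.integrable_mul (Lp.memLp U.snd)
  have i2 : IntegrableOn (fun x => f x * spaceDeriv U.snd x) (Ioo c d) := by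
    simpa only [hf, flux, mul_assoc] using integrable_energy U.fst.finiteNorm hvf
  have e : inner ℝ U F =
      ∫ x in Ioo c d, (f' x * U.snd x + f x * spaceDeriv U.snd x) := by
    rw [WithLp.prod_inner_apply, integral_add i1 i2, add_comm]
    congr 1
    · change inner ℝ U.snd F.snd = _
      rw [L2.inner_def]
      refine integral_congr_ae ?_
      filter_upwards [hsnd, hwd] with x h1 h2
      rw [h1, h2]
      rfl
    · change inner ℝ U.fst F.fst = _
      rw [EnergySpace.inner_def, hfst]
      simp only [hf, flux, mul_assoc]
  have i3 : IntegrableOn (fun x => f' x * U.snd x + f x * spaceDeriv U.snd x) (Ioo c d) := i1.add i2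
  rw [e]
  by_cases hw : a.IsWeak
  -- Weak case: `v` has an integrable weak derivative on all of `(c, d)`, so `1` is not a boundary
  -- point.
  · obtain ⟨g, hg, -, hwk⟩ := hv.1
    obtain ⟨hg1, hg2⟩ := hwk hw
    have hgs := weakDeriv_ae (isOpen_punctured c d) hg
    rw [restrict_punctured] at hgs
    exact integral_by_parts_of_tendsto_zero_both (a.c_lt_one.trans a.one_lt_d)
      (hg1.congr (ae_eq_refl _) hgs.symm) hv.2.1 hv.2.2 (Integrable.congr hg2 hgs.symm) hff' hf'i
  -- Strong case: integrate by parts on each side of `1`, where the transmission conditions make the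
  -- flux vanish.
  · have hl : Ioo c 1 ⊆ Ioo c d := a.Ioo_left_subset.trans sdiff_subset
    have hr : Ioo 1 d ⊆ Ioo c d := a.Ioo_right_subset.trans sdiff_subset
    have hws := integrableOn_sq_mul_spaceDeriv_sq hvf
    have hgv := (spaceDeriv_spec hvf).1
    have hws' : IntegrableOn (fun x => (1 - x) ^ 2 * spaceDeriv U.snd x ^ 2) (Ioo c 1) := by
      simpa only [sub_sq_comm] using hws.mono_set hl
    obtain ⟨-, hz1, hz2⟩ := hdom.strong hw
    rw [setIntegral_Ioo_split a.c_lt_one a.one_lt_d i3,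
      integral_by_parts_of_tendsto_zero a.c_lt_one (hgv.mono a.Ioo_left_subset) hv.2.1
        ((L2.integrable_sq _).mono_set hl)
        (fun x hx => integrableOn_of_sq_weight hx (hgv.mono a.Ioo_left_subset).2.1 hws')
        (hff'.mono hl) hz1 (hf'i.mono_set hl) (IntegrableOn.mono_set hf'L.integrable_sq hl)
        (i3.mono_set hl),
      integral_by_parts_of_tendsto_zero_right a.one_lt_d (hgv.mono a.Ioo_right_subset) hv.2.2
        ((L2.integrable_sq _).mono_set hr) (hws.mono_set hr)
        (hff'.mono hr) hz2 (hf'i.mono_set hr) (IntegrableOn.mono_set hf'L.integrable_sq hr)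
        (i3.mono_set hr), add_zero]

/-- Once `y_t` is known to be the second component of the orbit, the energy is half its squared
norm, which the isometric semigroup preserves. -/
theorem IsMildSolution.energy_eq {V : IntermediateSpace a} {y₀ : EnergySpace V} {y₁ : L2 c d}
    {y : ℝ → EnergySpace V} (hy : IsMildSolution V y₀ y₁ y) {t : ℝ} (ht : 0 ≤ t) :
    energy y t = 1 / 2 * ‖(WithLp.toLp 2 (y₀, y₁) : StateSpace V)‖ ^ 2 := by
  obtain ⟨S, hS, hA, hyS⟩ := hy.orbit
  set Y : StateSpace V := WithLp.toLp 2 (y₀, y₁) with hY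
  -- `P` is the first component viewed in `L²` and `Q` the second component; `P A = Q` is the
  -- equation `u_t = v`.
  have hd := hS.hasDerivWithinAt_comp hA
    ((EnergySpace.embedding V).comp (WithLp.fstL 2 ℝ (EnergySpace V) (L2 c d)))
    (WithLp.sndL 2 ℝ (EnergySpace V) (L2 c d)) (fun U F hUF => hUF.2.1) Y ht
  have hd2 : HasDerivWithinAt (fun s => (y s).toL2) (S t Y).snd (Ici 0) t :=
    hd.congr (fun s hs => congrArg EnergySpace.toL2 (hyS s hs))
      (congrArg EnergySpace.toL2 (hyS t ht))
  have hdt : timeDeriv y t = (S t Y).snd := hd2.derivWithin (uniqueDiffOn_Ici 0 t ht)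
  rw [← hS.norm_apply hA (fun U F hUF => hUF.inner_eq_zero) Y ht, WithLp.prod_norm_sq_eq_of_L2,
    ← hyS t ht, EnergySpace.norm_sq_eq, ← hdt, L2.norm_sq, energy, restrict_punctured,
    integral_add (L2.integrable_sq _) (spaceDeriv_spec (y t).finiteNorm).2, add_comm]

end Weighted

theorem proposition2p2 {c d : ℝ} (a : DegenerateWeight c d) (V : IntermediateSpace a)
    (y₀ : EnergySpace V) (y₁ : L2 c d) (y : ℝ → EnergySpace V)
    (hy : IsMildSolution V y₀ y₁ y) :
    ∀ t : ℝ, 0 ≤ t → energy y t = energy y 0 := by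
  intro t ht
  rw [hy.energy_eq ht, hy.energy_eq le_rfl]
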